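/- Let $d\ge 0$ be an integer, let $dm(x)=(2\pi)^{-d/2}dx$ and $d\gamma(x)=(2\pi)^{-d/2}e^{-|x|^2/2}dx$ on $\mathbb R^d$, and work in the complex spaces $L^2(m)$ and $L^2(\gamma)$. Let $U:L^2(\gamma)\to L^2(m)$ be the unitary operator $U=\delta\circ E$, where $Ef(x)=e^{-|x|^2/4}f(x)$ and $\delta f(x)=2^{d/4}f(\sqrt2\,x)$. For $u,v\in\mathbb R^d$ let $e^{i(uX+vD)}$ be the unitary operator on $L^2(m)$ given by $e^{i(uX+vD)}f(y)=e^{iu\cdot y+\frac i2u\cdot v}f(y+v)$, and put $e^{i(uQ+vP)}=U^{-1}e^{i(uX+vD)}U$. For a Schwartz function $a$ on $\mathbb R^d\times\mathbb R^d$ let $$\widehat a(u,v)=\int_{\mathbb R^{2d}}a(x,\xi)e^{-i(x\cdot u+\xi\cdot v)}\,dm(x)\,dm(\xi),$$ let $a(X,D)$ be the bounded operator $f\mapsto\int_{\mathbb R^{2d}}\widehat a(u,v)\,e^{i(uX+vD)}f\,dm(u)\,dm(v)$ on $L^2(m)$, and let $$a(Q,P)=U^{-1}a(X,D)U=\int_{\mathbb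 R^{2d}}\widehat a(u,v)\,e^{i(uQ+vP)}\,dm(u)\,dm(v)\quad\text{(strongly)}$$ on $L^2(\gamma)$. For $\operatorname{Re}s>0$ let $a_s(x,\xi)=\exp(-s(|x|^2+|\xi|^2))$. Let $L$ be the Ornstein–Uhlenbeck operator on $L^2(\gamma)$, that is, the closure of $f\mapsto-\Delta f+x\cdot\nabla f$ on $C_c^2(\mathbb R^d)$. For an operator $A$ that generates a $C_0$-semigroup, $\exp(tA)$, $t\ge0$, denotes that semigroup. **Theorem.** (i) The operator $-L$ generates a $C_0$-semigroup $(\exp(-tL))_{t\ge0}$ on $L^2(\gamma)$, and it is the only $C_0$-semigroup with this generator. For all $t>0$, with $s=\dfrac{1-e^{-t}}{1+e^{-t}}>0$, $$\exp(-tL)=(1+s)^d\,a_s(Q,P).$$ (ii) For all $z\in\mathbb C$ with $\operatorname{Re}z>0$ the operator $-zL$ generates a unique $C_0$-semigroup on $L^2(\gamma)$; let $\exp(-zL)$ be its value at time $1$. The map $z\mapsto\exp(-zL)$ is holomorphic on $\{\operatorname{Re}z>0\}$ for the operator norm, it agrees with the semigroup in (i) for $z=t>0$, and, with $s=\dfrac{1-e^{-z}}{1+e^{-z}}$,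 which has $\operatorname{Re}s>0$, $$\exp(-zL)=(1+s)^d\,a_s(Q,P)\qquad(\operatorname{Re}z>0).$$ -/

import Mathlib

open MeasureTheory Filter Topology
open scoped NNReal ENNReal SchwartzMap ContDiff FourierTransform

noncomputable section

namespace GaussianWeyl

/-- `ℝ^d` with its Euclidean norm. -/
abbrev Euc (d : ℕ) : Type := EuclideanSpace ℝ (Fin d)

section Symbol
variable {d : ℕ}

/-- `|x|² + |ξ|²` on phase space `ℝ^d × ℝ^d`. -/
def phaseSq (d : ℕ) (p : Euc d × Euc d) : ℝ := ‖p.1‖ ^ 2 + ‖p.2‖ ^ 2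

/-- The derivative of `phaseSq`. -/
def phaseBilin (d : ℕ) : (Euc d × Euc d) →L[ℝ] (Euc d × Euc d) →L[ℝ] ℝ :=
  (2 : ℝ) • ((innerSL ℝ).bilinearComp (.fst ℝ (Euc d) (Euc d)) (.fst ℝ (Euc d) (Euc d)) +
    (innerSL ℝ).bilinearComp (.snd ℝ (Euc d) (Euc d)) (.snd ℝ (Euc d) (Euc d)))

theorem hasFDerivAt_phaseSq (p : Euc d × Euc d) :
    HasFDerivAt (phaseSq d) (phaseBilin d p) p := by
  have h1 : HasFDerivAt (fun q : Euc d × Euc d => ‖q.1‖ ^ 2)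
      (2 • (innerSL ℝ p.1).comp (.fst ℝ (Euc d) (Euc d))) p := by
    simpa using! (hasFDerivAt_fst (𝕜 := ℝ) (p := p)).norm_sq
  have h2 : HasFDerivAt (fun q : Euc d × Euc d => ‖q.2‖ ^ 2)
      (2 • (innerSL ℝ p.2).comp (.snd ℝ (Euc d) (Euc d))) p := by
    simpa using! (hasFDerivAt_snd (𝕜 := ℝ) (p := p)).norm_sq
  convert! h1.add h2 using 1
  ext v <;> simp [phaseBilin]

theorem norm_sq_le_phaseSq (p : Euc d × Euc d) : ‖p‖ ^ 2 ≤ phaseSq d p := by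
  rw [Prod.norm_def, phaseSq]
  rcases max_cases ‖p.1‖ ‖p.2‖ with h | h <;> rw [h.1] <;> nlinarith [sq_nonneg ‖p.1‖, sq_nonneg ‖p.2‖]

theorem contDiff_phaseExp (s : ℂ) :
    ContDiff ℝ ∞ (fun p : Euc d × Euc d => Complex.exp (-s * (phaseSq d p : ℂ))) := by
  have : ContDiff ℝ ∞ (phaseSq d) :=
    (contDiff_fst.norm_sq ℝ).add (contDiff_snd.norm_sq ℝ)
  exact (contDiff_const.mul (Complex.ofRealCLM.contDiff.comp this)).cexp

theorem phaseExp_bound {c : ℝ} (hc : 0 < c) (k : ℕ) :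
    ∃ C : ℝ, ∀ r : ℝ, 0 ≤ r → (1 + r) ^ k * Real.exp (-(c * r ^ 2)) ≤ C := by
  refine ⟨(k.factorial : ℝ) * Real.exp (1 + 1 / c), fun r hr => ?_⟩
  have h1 : (1 + r) ^ k ≤ (k.factorial : ℝ) * Real.exp (1 + r) := by
    have := Real.pow_div_factorial_le_exp (1 + r) (by positivity) k
    rw [div_le_iff₀ (by positivity)] at this
    linarith
  have h2 : r ≤ 1 / c + c * r ^ 2 := by
    have : 0 ≤ c * (r - 1 / c) ^ 2 := by positivity
    have e : c * (r - 1 / c) ^ 2 = c * r ^ 2 - 2 * r + 1 / c := by field_simp; ring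
    nlinarith
  calc (1 + r) ^ k * Real.exp (-(c * r ^ 2))
      ≤ (k.factorial : ℝ) * Real.exp (1 + r) * Real.exp (-(c * r ^ 2)) := by gcongr
    _ = (k.factorial : ℝ) * Real.exp (1 + r - c * r ^ 2) := by
        rw [mul_assoc, ← Real.exp_add]; ring_nf
    _ ≤ _ := by gcongr; linarith

theorem phaseExp_decay {s : ℂ} (hs : 0 < s.re) (n : ℕ) :
    ∀ {V : Type} [NormedAddCommGroup V] [NormedSpace ℂ V] (G : Euc d × Euc d → V),
      G.HasTemperateGrowth → ∀ k : ℕ, ∃ C : ℝ, ∀ p : Euc d × Euc d,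
      ‖p‖ ^ k * ‖iteratedFDeriv ℝ n
        (fun q => Complex.exp (-s * (phaseSq d q : ℂ)) • G q) p‖ ≤ C := by
  induction n with
  | zero =>
    intro V _ _ G hG k
    obtain ⟨m, C, hC⟩ := hG.2 0
    obtain ⟨K, hK⟩ := phaseExp_bound hs (k + m)
    refine ⟨|C| * K, fun p => ?_⟩
    have hG' : ‖G p‖ ≤ |C| * (1 + ‖p‖) ^ m := by
      have := hC p
      rw [norm_iteratedFDeriv_zero] at this
      exact this.trans (by gcongr; exact le_abs_self C)
    rw [norm_iteratedFDeriv_zero, norm_smul, Complex.norm_exp]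
    have e : (-s * (phaseSq d p : ℂ)).re = -(s.re * phaseSq d p) := by simp
    rw [e]
    have h3 : Real.exp (-(s.re * phaseSq d p)) ≤ Real.exp (-(s.re * ‖p‖ ^ 2)) := by
      gcongr; exact norm_sq_le_phaseSq p
    calc ‖p‖ ^ k * (Real.exp (-(s.re * phaseSq d p)) * ‖G p‖)
        ≤ (1 + ‖p‖) ^ k * (Real.exp (-(s.re * ‖p‖ ^ 2)) * (|C| * (1 + ‖p‖) ^ m)) := by
          gcongr; linarith
      _ = |C| * ((1 + ‖p‖) ^ (k + m) * Real.exp (-(s.re * ‖p‖ ^ 2))) := by ring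
      _ ≤ |C| * K := by gcongr; exact hK _ (norm_nonneg p)
  | succ n ih =>
    intro V _ _ G hG k
    have hG1 : (fun p => fderiv ℝ G p +
        ContinuousLinearMap.smulRightL ℝ (Euc d × Euc d) V (phaseBilin d p) (-s • G p)).HasTemperateGrowth := by
      have h1 : (fun p => -s • G p).HasTemperateGrowth :=
        (Function.HasTemperateGrowth.const (-s)).fun_smul hG
      have h2 := (ContinuousLinearMap.smulRightL ℝ (Euc d × Euc d) V).bilinear_hasTemperateGrowth
        (phaseBilin d).hasTemperateGrowth h1
      have h3 : (fderiv ℝ G).HasTemperateGrowth := by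
        refine ⟨hG.1.fderiv_right (by simp), fun j => ?_⟩
        obtain ⟨m, C, hC⟩ := hG.2 (j + 1)
        exact ⟨m, C, fun x => by rw [norm_iteratedFDeriv_fderiv]; exact hC x⟩
      exact h3.fun_add h2
    obtain ⟨C, hC⟩ := ih _ hG1 k
    refine ⟨C, fun p => ?_⟩
    rw [← norm_iteratedFDeriv_fderiv]
    have key : fderiv ℝ (fun q => Complex.exp (-s * (phaseSq d q : ℂ)) • G q) =
        fun q => Complex.exp (-s * (phaseSq d q : ℂ)) • (fderiv ℝ G q +
          ContinuousLinearMap.smulRightL ℝ (Euc d × Euc d) V (phaseBilin d q) (-s • G q)) := by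
      funext q
      have hq := hasFDerivAt_phaseSq (d := d) q
      have hq2 : HasFDerivAt (fun q => Complex.exp (-s * (phaseSq d q : ℂ)))
          (Complex.exp (-s * (phaseSq d q : ℂ)) •
            (-s • Complex.ofRealCLM.comp (phaseBilin d q))) q :=
        ((Complex.ofRealCLM.hasFDerivAt.comp q hq).const_mul (-s)).cexp
      have hq3 := hq2.smul (hG.1.differentiable (by simp) q).hasFDerivAt
      refine hq3.fderiv.trans ?_
      refine ContinuousLinearMap.ext fun v => ?_
      change Complex.exp (-s * (phaseSq d q : ℂ)) • fderiv ℝ G q v +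
          (Complex.exp (-s * (phaseSq d q : ℂ)) • (-s • ((phaseBilin d q v : ℝ) : ℂ))) • G q =
        Complex.exp (-s * (phaseSq d q : ℂ)) •
          (fderiv ℝ G q v + (phaseBilin d q v : ℝ) • (-s • G q))
      rw [smul_add]
      congr 1
      rw [smul_assoc, ← Complex.coe_smul (phaseBilin d q v), smul_eq_mul,
        mul_comm (-s) ((phaseBilin d q v : ℝ) : ℂ), mul_smul]
    rw [key]
    exact hC p

/-- The Schwartz function `a_s(x, ξ) = exp(-s(|x|² + |ξ|²))`, for `Re s > 0`. -/
def gaussianSymbol (d : ℕ) (s : ℂ) (hs : 0 < s.re) : 𝓢(Euc d × Euc d, ℂ) where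
  toFun p := Complex.exp (-s * ((‖p.1‖ ^ 2 + ‖p.2‖ ^ 2 : ℝ) : ℂ))
  smooth' := contDiff_phaseExp s
  decay' k n := by
    simpa [phaseSq] using phaseExp_decay (d := d) hs n (fun _ => (1 : ℂ)) (.const 1) k

end Symbol
section WeightedComp
variable {α β : Type*} [MeasurableSpace α] [MeasurableSpace β] {μ : Measure α} {ν : Measure β}

/-- The condition on a nowhere vanishing weight `w` and a measurable isomorphism `φ` that makes
`f ↦ w · (f ∘ φ)` a unitary operator `L²(ν) → L²(μ)`. -/
structure IsUnitaryWeight (φ : α ≃ᵐ β) (w : α → ℂ) (μ : Measure α) (ν : Measure β) : Prop where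
  measurable : Measurable w
  ne_zero : ∀ x, w x ≠ 0
  map_eq : (μ.withDensity fun x => ‖w x‖ₑ ^ 2).map φ = ν

namespace IsUnitaryWeight
variable {φ : α ≃ᵐ β} {w : α → ℂ}

theorem ac (h : IsUnitaryWeight φ w μ ν) : μ ≪ μ.withDensity fun x => ‖w x‖ₑ ^ 2 :=
  withDensity_absolutelyContinuous' (h.measurable.enorm.pow_const 2).aemeasurable
    (ae_of_all _ fun x => by simpa using h.ne_zero x)

theorem qmp (h : IsUnitaryWeight φ w μ ν) : Measure.QuasiMeasurePreserving φ μ ν :=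
  ⟨φ.measurable, by rw [← h.map_eq]; exact h.ac.map φ.measurable⟩

theorem qmp_symm (h : IsUnitaryWeight φ w μ ν) : Measure.QuasiMeasurePreserving φ.symm ν μ :=
  ⟨φ.symm.measurable, by
    rw [← h.map_eq, MeasurableEquiv.map_symm_map]
    exact withDensity_absolutelyContinuous _ _⟩

theorem eLpNorm_eq (h : IsUnitaryWeight φ w μ ν) {f : β → ℂ} (hf : AEStronglyMeasurable f ν) :
    eLpNorm (fun x => w x * f (φ x)) 2 μ = eLpNorm f 2 ν := by
  have hf' : AEMeasurable (fun x => ‖f x‖ₑ ^ 2) ν := hf.enorm.pow_const 2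
  rw [eLpNorm_eq_lintegral_rpow_enorm_toReal (by simp) (by simp),
    eLpNorm_eq_lintegral_rpow_enorm_toReal (by simp) (by simp)]
  congr 1
  simp only [ENNReal.toReal_ofNat, ENNReal.rpow_ofNat, enorm_mul, mul_pow]
  have e : ∫⁻ x, ‖f x‖ₑ ^ 2 ∂ν = ∫⁻ x, ‖f (φ x)‖ₑ ^ 2 ∂(μ.withDensity fun x => ‖w x‖ₑ ^ 2) := by
    rw [← h.map_eq, lintegral_map_equiv]
  rw [e, lintegral_withDensity_eq_lintegral_mul₀' (h.measurable.enorm.pow_const 2).aemeasurable]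
  · rfl
  · refine AEMeasurable.comp_measurable (g := fun x => ‖f x‖ₑ ^ 2) ?_ φ.measurable
    rwa [h.map_eq]

theorem memLp (h : IsUnitaryWeight φ w μ ν) (f : Lp ℂ 2 ν) :
    MemLp (fun x => w x * f (φ x)) 2 μ :=
  ⟨h.measurable.aestronglyMeasurable.mul
      ((Lp.aestronglyMeasurable f).comp_quasiMeasurePreserving h.qmp),
    by rw [h.eLpNorm_eq (Lp.aestronglyMeasurable f)]; exact Lp.eLpNorm_lt_top f⟩

/-- `f ↦ w · (f ∘ φ)` as a linear isometry `L²(ν) → L²(μ)`. -/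
def toLinearIsometry (h : IsUnitaryWeight φ w μ ν) : Lp ℂ 2 ν →ₗᵢ[ℂ] Lp ℂ 2 μ where
  toFun f := (h.memLp f).toLp _
  map_add' f g := by
    rw [← MemLp.toLp_add, MemLp.toLp_eq_toLp_iff]
    filter_upwards [h.qmp.ae (Lp.coeFn_add f g)] with x hx
    simp only [hx, Pi.add_apply, mul_add]
  map_smul' c f := by
    rw [RingHom.id_apply, ← MemLp.toLp_const_smul, MemLp.toLp_eq_toLp_iff]
    filter_upwards [h.qmp.ae (Lp.coeFn_smul c f)] with x hx
    simp only [hx, Pi.smul_apply, smul_eq_mul]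
    ring
  norm_map' f := by
    change ‖(h.memLp f).toLp _‖ = ‖f‖
    rw [Lp.norm_toLp, Lp.norm_def, h.eLpNorm_eq (Lp.aestronglyMeasurable f)]

theorem surjective (h : IsUnitaryWeight φ w μ ν) : Function.Surjective h.toLinearIsometry := by
  intro g
  have hm : AEStronglyMeasurable (fun y => (w (φ.symm y))⁻¹ * g (φ.symm y)) ν :=
    (h.measurable.comp φ.symm.measurable).inv.aestronglyMeasurable.mul
      ((Lp.aestronglyMeasurable g).comp_quasiMeasurePreserving h.qmp_symm)
  have e : (fun x => w x * ((w (φ.symm (φ x)))⁻¹ * g (φ.symm (φ x)))) = g := by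
    funext x
    simp [h.ne_zero x]
  have hL : MemLp (fun y => (w (φ.symm y))⁻¹ * g (φ.symm y)) 2 ν :=
    ⟨hm, by rw [← h.eLpNorm_eq hm, e]; exact Lp.eLpNorm_lt_top g⟩
  refine ⟨hL.toLp _, ?_⟩
  apply Lp.ext
  refine (MemLp.coeFn_toLp (h.memLp _)).trans ?_
  filter_upwards [h.qmp.ae hL.coeFn_toLp] with x hx
  rw [hx]
  exact congrFun e x

/-- `f ↦ w · (f ∘ φ)` as a unitary operator `L²(ν) → L²(μ)`. -/
def toUnitary (h : IsUnitaryWeight φ w μ ν) : Lp ℂ 2 ν ≃ₗᵢ[ℂ] Lp ℂ 2 μ :=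
  LinearIsometryEquiv.ofSurjective h.toLinearIsometry h.surjective

theorem coeFn_toUnitary (h : IsUnitaryWeight φ w μ ν) (f : Lp ℂ 2 ν) :
    h.toUnitary f =ᵐ[μ] fun x => w x * f (φ x) :=
  MemLp.coeFn_toLp (h.memLp f)

end IsUnitaryWeight
end WeightedComp
section Spaces
variable (d : ℕ)

/-- Normalised Lebesgue measure `dm(x) = (2π)^{-d/2} dx`. -/
def lebM : Measure (Euc d) := ENNReal.ofReal ((2 * Real.pi) ^ (-(d : ℝ) / 2)) • volume

/-- The standard Gaussian measure `dγ(x) = (2π)^{-d/2} exp(-|x|²/2) dx`. -/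
def gaussM : Measure (Euc d) :=
  volume.withDensity fun x =>
    ENNReal.ofReal ((2 * Real.pi) ^ (-(d : ℝ) / 2) * Real.exp (-‖x‖ ^ 2 / 2))

/-- The complex Hilbert space `L²(ℝ^d, m)`. -/
abbrev L2m : Type := Lp ℂ 2 (lebM d)
/-- The complex Hilbert space `L²(ℝ^d, γ)`. -/
abbrev L2γ : Type := Lp ℂ 2 (gaussM d)

theorem lebM_const_pos : 0 < (2 * Real.pi) ^ (-(d : ℝ) / 2) := by positivity

instance : (lebM d).IsAddHaarMeasure := by
  unfold lebM
  exact Measure.IsAddHaarMeasure.smul _ (by simpa using lebM_const_pos d) ENNReal.ofReal_ne_top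

theorem gaussM_eq : gaussM d = (lebM d).withDensity fun x => ENNReal.ofReal (Real.exp (-‖x‖ ^ 2 / 2)) := by
  have hm : Measurable fun x : Euc d => ENNReal.ofReal (Real.exp (-‖x‖ ^ 2 / 2)) := by fun_prop
  rw [gaussM, lebM, withDensity_smul_measure, ← withDensity_smul _ hm]
  congr 1
  funext x
  rw [Pi.smul_apply, smul_eq_mul, ENNReal.ofReal_mul (lebM_const_pos d).le]

instance : IsFiniteMeasureOnCompacts (gaussM d) := by
  refine ⟨fun K hK => lt_of_le_of_lt ?_ (hK.measure_lt_top (μ := lebM d))⟩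
  rw [gaussM_eq, withDensity_apply' _ K]
  calc _ ≤ ∫⁻ _ in K, 1 ∂(lebM d) := lintegral_mono fun x => by
        rw [← ENNReal.ofReal_one]
        refine ENNReal.ofReal_le_ofReal (Real.exp_le_one_iff.2 ?_)
        have := sq_nonneg ‖x‖
        linarith
    _ = _ := by simp

instance : (gaussM d).IsOpenPosMeasure := by
  have h : (volume : Measure (Euc d)) ≪ gaussM d :=
    withDensity_absolutelyContinuous' (by fun_prop) (ae_of_all _ fun x => by
      have := lebM_const_pos d
      simp only [ne_eq, ENNReal.ofReal_eq_zero, not_le]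
      positivity)
  exact h.isOpenPosMeasure

theorem isUnitaryWeight_E : IsUnitaryWeight (MeasurableEquiv.refl (Euc d))
    (fun x => (Real.exp (-‖x‖ ^ 2 / 4) : ℂ)) (lebM d) (gaussM d) where
  measurable := by fun_prop
  ne_zero x := by exact_mod_cast (Real.exp_pos _).ne'
  map_eq := by
    rw [gaussM_eq]
    change Measure.map id _ = _
    rw [Measure.map_id]
    congr 1
    funext x
    rw [← ofReal_norm, Complex.norm_real, Real.norm_of_nonneg (Real.exp_pos _).le,
      ← ENNReal.ofReal_pow (Real.exp_pos _).le, ← Real.exp_nat_mul]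
    congr 2
    push_cast
    ring

theorem isUnitaryWeight_dil : IsUnitaryWeight
    (Homeomorph.smulOfNeZero (√2 : ℝ) (by positivity : (√2 : ℝ) ≠ 0) : Euc d ≃ₜ Euc d).toMeasurableEquiv
    (fun _ => (((2 : ℝ) ^ ((d : ℝ) / 4) : ℝ) : ℂ)) (lebM d) (lebM d) where
  measurable := by fun_prop
  ne_zero x := by
    have : 0 < (2 : ℝ) ^ ((d : ℝ) / 4) := by positivity
    exact_mod_cast this.ne'
  map_eq := by
    have h2 : 0 < (2 : ℝ) ^ ((d : ℝ) / 4) := by positivity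
    rw [withDensity_const, Measure.map_smul]
    change _ • Measure.map (fun x => √2 • x) (lebM d) = _
    rw [Measure.map_addHaar_smul _ (by positivity), smul_smul]
    convert one_smul ℝ≥0∞ _ using 2
    rw [← ofReal_norm, Complex.norm_real, Real.norm_of_nonneg h2.le,
      ← ENNReal.ofReal_pow h2.le, ← ENNReal.ofReal_mul (by positivity), ENNReal.ofReal_eq_one,
      finrank_euclideanSpace_fin, abs_of_nonneg (by positivity), Real.sqrt_eq_rpow,
      ← Real.rpow_mul_natCast (by positivity), ← Real.rpow_mul_natCast (by positivity),
      ← Real.rpow_neg (by positivity), ← Real.rpow_add (by positivity)]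
    convert Real.rpow_zero _ using 2
    push_cast
    ring

theorem isUnitaryWeight_weyl (u v : Euc d) : IsUnitaryWeight (MeasurableEquiv.addRight v)
    (fun y => Complex.exp (Complex.I * (inner ℝ u y : ℝ) + Complex.I / 2 * (inner ℝ u v : ℝ)))
    (lebM d) (lebM d) where
  measurable := by fun_prop
  ne_zero x := Complex.exp_ne_zero _
  map_eq := by
    have : (fun y : Euc d => ‖Complex.exp (Complex.I * (inner ℝ u y : ℝ) +
        Complex.I / 2 * (inner ℝ u v : ℝ))‖ₑ ^ 2) = 1 := by
      funext y
      rw [← ofReal_norm, Complex.norm_exp]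
      simp
    rw [this, withDensity_one]
    exact (measurePreserving_add_right (lebM d) v).map_eq

/-- `E f = e f`, `e(x) = exp(-|x|²/4)`, unitary from `L²(γ)` onto `L²(m)`. -/
def unitaryE : L2γ d ≃ₗᵢ[ℂ] L2m d := (isUnitaryWeight_E d).toUnitary

/-- The dilation `δ f(x) = 2^{d/4} f(√2 x)`, unitary on `L²(m)`. -/
def dilation : L2m d ≃ₗᵢ[ℂ] L2m d := (isUnitaryWeight_dil d).toUnitary

/-- `U = δ ∘ E`, unitary from `L²(γ)` onto `L²(m)`. -/
def unitaryU : L2γ d ≃ₗᵢ[ℂ] L2m d := (unitaryE d).trans (dilation d)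

variable {d}
/-- The unitary operator `exp(i(uX + vD))` on `L²(m)`:
`exp(i(uX + vD)) f(y) = exp(i u·y + (i/2) u·v) f(y + v)`. -/
def expXD (u v : Euc d) : L2m d ≃ₗᵢ[ℂ] L2m d := (isUnitaryWeight_weyl d u v).toUnitary

/-- The unitary operator `exp(i(uQ + vP)) = U⁻¹ ∘ exp(i(uX + vD)) ∘ U` on `L²(γ)`. -/
def expQP (u v : Euc d) : L2γ d ≃ₗᵢ[ℂ] L2γ d :=
  ((unitaryU d).trans (expXD u v)).trans (unitaryU d).symm

/-- The Fourier transform on phase space,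
`â(u, v) = ∫∫ a(x, ξ) exp(-i(x·u + ξ·v)) dm(x) dm(ξ)`. -/
def phaseFourier (a : 𝓢(Euc d × Euc d, ℂ)) (u v : Euc d) : ℂ :=
  ∫ p : Euc d × Euc d, Complex.exp (-Complex.I * ((inner ℝ p.1 u + inner ℝ p.2 v : ℝ) : ℂ)) * a p
    ∂((lebM d).prod (lebM d))

theorem isUnitaryWeight_mod {α : Type*} [MeasurableSpace α] (μ : Measure α) {c : α → ℂ}
    (hc : Measurable c) (h1 : ∀ x, ‖c x‖ = 1) :
    IsUnitaryWeight (MeasurableEquiv.refl α) c μ μ where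
  measurable := hc
  ne_zero x := by rw [← norm_pos_iff, h1]; exact one_pos
  map_eq := by
    have : (fun x => ‖c x‖ₑ ^ 2) = 1 := by
      funext x
      rw [← ofReal_norm, h1]
      simp
    rw [this, withDensity_one]
    exact Measure.map_id

theorem continuous_mod {α X : Type*} [MeasurableSpace α] {μ : Measure α} [TopologicalSpace X]
    [FirstCountableTopology X] {c : X → α → ℂ} (hc : ∀ p, Measurable (c p))
    (h1 : ∀ p x, ‖c p x‖ = 1) (hcont : ∀ x, Continuous fun p => c p x) (g : Lp ℂ 2 μ) :
    Continuous fun p => (isUnitaryWeight_mod μ (hc p) (h1 p)).toUnitary g := by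
  rw [continuous_iff_continuousAt]
  intro q
  rw [ContinuousAt, Lp.tendsto_Lp_iff_tendsto_eLpNorm']
  have e : ∀ p, eLpNorm (⇑((isUnitaryWeight_mod μ (hc p) (h1 p)).toUnitary g) -
      ⇑((isUnitaryWeight_mod μ (hc q) (h1 q)).toUnitary g)) 2 μ =
      (∫⁻ x, ‖(c p x - c q x) * g x‖ₑ ^ 2 ∂μ) ^ ((1 : ℝ) / 2) := by
    intro p
    have : ⇑((isUnitaryWeight_mod μ (hc p) (h1 p)).toUnitary g) -
        ⇑((isUnitaryWeight_mod μ (hc q) (h1 q)).toUnitary g) =ᵐ[μ]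
        fun x => (c p x - c q x) * g x := by
      filter_upwards [(isUnitaryWeight_mod μ (hc p) (h1 p)).coeFn_toUnitary g,
        (isUnitaryWeight_mod μ (hc q) (h1 q)).coeFn_toUnitary g] with x hx hy
      rw [Pi.sub_apply, hx, hy, MeasurableEquiv.refl_apply, sub_mul]
    rw [eLpNorm_congr_ae this, eLpNorm_eq_lintegral_rpow_enorm_toReal (by simp) (by simp)]
    simp
  have key : Tendsto (fun p => ∫⁻ x, ‖(c p x - c q x) * g x‖ₑ ^ 2 ∂μ) (𝓝 q)
      (𝓝 (∫⁻ _, 0 ∂μ)) := by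
    refine tendsto_lintegral_filter_of_dominated_convergence' (fun x => 4 * ‖g x‖ₑ ^ 2) ?_ ?_ ?_ ?_
    · exact Eventually.of_forall fun p =>
        ((((hc p).sub (hc q)).aemeasurable.mul (Lp.aestronglyMeasurable g).aemeasurable).enorm.pow_const 2)
    · refine Eventually.of_forall fun p => ae_of_all _ fun x => ?_
      rw [enorm_mul, mul_pow]
      gcongr
      have : ‖c p x - c q x‖ₑ ≤ 2 := by
        refine (enorm_sub_le).trans ?_
        rw [← ofReal_norm, ← ofReal_norm, h1, h1]
        norm_num
      calc ‖c p x - c q x‖ₑ ^ 2 ≤ 2 ^ 2 := by gcongr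
        _ = 4 := by norm_num
    · have h2 := lintegral_rpow_enorm_lt_top_of_eLpNorm_lt_top (by simp) (by simp)
        (Lp.eLpNorm_lt_top g)
      simp only [ENNReal.toReal_ofNat, ENNReal.rpow_ofNat] at h2
      rw [lintegral_const_mul' _ _ (by simp)]
      exact ENNReal.mul_ne_top (by simp) h2.ne
    · refine ae_of_all _ fun x => ?_
      have h3 : Continuous fun p => ‖(c p x - c q x) * g x‖ₑ ^ 2 :=
        ENNReal.continuous_pow 2 |>.comp (((hcont x).sub continuous_const).mul continuous_const).enorm
      simpa using h3.tendsto q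
  simp only [e]
  have := ((ENNReal.continuous_rpow_const (y := (1 : ℝ) / 2)).tendsto _).comp key
  simpa [Function.comp_def] using this

theorem continuous_expXD (f : L2m d) :
    Continuous fun p : Euc d × Euc d => expXD p.1 p.2 f := by
  let c : Euc d × Euc d → Euc d → ℂ := fun p y =>
    Complex.exp (Complex.I * (inner ℝ p.1 y : ℝ) + Complex.I / 2 * (inner ℝ p.1 p.2 : ℝ))
  have hc : ∀ p, Measurable (c p) := fun p => by fun_prop
  have h1 : ∀ p y, ‖c p y‖ = 1 := fun p y => by
    simp [c, Complex.norm_exp]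
  have hcont : ∀ y, Continuous fun p => c p y := fun y => by fun_prop
  let τ : Euc d × Euc d → C(Euc d, Euc d) := fun p => ⟨fun y => y + p.2, by fun_prop⟩
  have hτ : Continuous τ := ContinuousMap.continuous_of_continuous_uncurry _ (by
    simp only [τ, Function.uncurry_def, ContinuousMap.coe_mk]; fun_prop)
  have hmp : ∀ p, MeasurePreserving (τ p) (lebM d) (lebM d) := fun p =>
    measurePreserving_add_right (lebM d) p.2
  let T : Euc d × Euc d → L2m d := fun p => Lp.compMeasurePreserving (τ p) (hmp p) f
  have hT : Continuous T := continuous_const.compMeasurePreservingLp hτ hmp (by simp)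
  have e : ∀ p, expXD p.1 p.2 f = (isUnitaryWeight_mod _ (hc p) (h1 p)).toUnitary (T p) := by
    intro p
    apply Lp.ext
    filter_upwards [(isUnitaryWeight_weyl d p.1 p.2).coeFn_toUnitary f,
      (isUnitaryWeight_mod (lebM d) (hc p) (h1 p)).coeFn_toUnitary (T p),
      Lp.coeFn_compMeasurePreserving f (hmp p)] with y h1 h2 h3
    rw [expXD, h1, h2, MeasurableEquiv.refl_apply, h3]
    rfl
  simp only [e]
  rw [continuous_iff_continuousAt]
  intro q
  have hq := (continuous_mod hc h1 hcont (T q)).tendsto q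
  rw [ContinuousAt, tendsto_iff_norm_sub_tendsto_zero] at *
  have hTq := tendsto_iff_norm_sub_tendsto_zero.1 (hT.tendsto q)
  refine squeeze_zero (fun _ => norm_nonneg _) (fun p => ?_) (by simpa using hTq.add hq)
  set M := (isUnitaryWeight_mod (lebM d) (hc p) (h1 p)).toUnitary
  calc _ ≤ ‖M (T p) - M (T q)‖ + _ := norm_sub_le_norm_sub_add_norm_sub _ (M (T q)) _
    _ = _ := by rw [← map_sub, LinearIsometryEquiv.norm_map]

theorem integrable_phaseFourier (a : 𝓢(Euc d × Euc d, ℂ)) :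
    Integrable (fun p : Euc d × Euc d => phaseFourier a p.1 p.2) ((lebM d).prod (lebM d)) := by
  let V := WithLp 2 (Euc d × Euc d)
  let b : 𝓢(V, ℂ) := SchwartzMap.compCLMOfContinuousLinearEquiv ℂ
    (WithLp.prodContinuousLinearEquiv 2 ℝ (Euc d) (Euc d)) a
  have h2π : (2 * Real.pi)⁻¹ ≠ 0 := by positivity
  let L : (Euc d × Euc d) ≃L[ℝ] V :=
    (ContinuousLinearEquiv.smulLeft (Units.mk0 _ h2π)).trans
      (WithLp.prodContinuousLinearEquiv 2 ℝ (Euc d) (Euc d)).symm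
  let c : 𝓢(Euc d × Euc d, ℂ) := SchwartzMap.compCLMOfContinuousLinearEquiv ℂ L (𝓕 b)
  let K : ℝ≥0∞ := ENNReal.ofReal ((2 * Real.pi) ^ (-(d : ℝ) / 2))
  have hprod : (lebM d).prod (lebM d) = (K * K) • (volume : Measure (Euc d × Euc d)) := by
    rw [lebM, Measure.prod_smul_left, Measure.prod_smul_right, smul_smul]
    rfl
  have e : (fun p : Euc d × Euc d => phaseFourier a p.1 p.2) = fun p => (K * K).toReal • c p := by
    funext p
    rw [phaseFourier, hprod, integral_smul_measure]
    congr 1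
    change _ = 𝓕 (b : V → ℂ) (L p)
    rw [Real.fourier_eq']
    rw [← (WithLp.volume_preserving_toLp (Euc d) (Euc d)).integral_comp
      (MeasurableEquiv.toLp 2 (Euc d × Euc d)).measurableEmbedding]
    refine integral_congr_ae (ae_of_all _ fun x => ?_)
    have hin : inner ℝ (WithLp.toLp 2 x : V) (L p) =
        (2 * Real.pi)⁻¹ * (inner ℝ x.1 p.1 + inner ℝ x.2 p.2) := by
      rw [WithLp.prod_inner_apply]
      change inner ℝ x.1 ((2 * Real.pi)⁻¹ • p.1) + inner ℝ x.2 ((2 * Real.pi)⁻¹ • p.2) = _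
      rw [inner_smul_right, inner_smul_right]
      ring
    change _ = Complex.exp (((-2 * Real.pi * inner ℝ (WithLp.toLp 2 x : V) (L p) : ℝ) : ℂ) *
      Complex.I) * a x
    rw [hin]
    have : -2 * Real.pi * ((2 * Real.pi)⁻¹ * (inner ℝ x.1 p.1 + inner ℝ x.2 p.2)) =
        -(inner ℝ x.1 p.1 + inner ℝ x.2 p.2) := by
      field_simp
    rw [this]
    push_cast
    ring_nf
  rw [e]
  have : (volume : Measure (Euc d × Euc d)).IsAddHaarMeasure :=
    inferInstanceAs (Measure.IsAddHaarMeasure ((volume : Measure (Euc d)).prod volume))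
  rw [hprod]
  exact Integrable.smul (K * K).toReal ((c.integrable (μ := volume)).smul_measure
    (ENNReal.mul_ne_top ENNReal.ofReal_ne_top ENNReal.ofReal_ne_top))

theorem integrable_weyl (a : 𝓢(Euc d × Euc d, ℂ)) (f : L2m d) :
    Integrable (fun p : Euc d × Euc d => phaseFourier a p.1 p.2 • expXD p.1 p.2 f)
      ((lebM d).prod (lebM d)) := by
  refine (integrable_phaseFourier a).norm.mul_const ‖f‖ |>.mono'
    ((integrable_phaseFourier a).aestronglyMeasurable.smul
      (continuous_expXD f).aestronglyMeasurable) (ae_of_all _ fun p => ?_)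
  rw [norm_smul, LinearIsometryEquiv.norm_map]

/-- The Weyl calculus of `(X, D)` on `L²(m)`:
`a(X, D) f = ∫∫ â(u, v) exp(i(uX + vD)) f dm(u) dm(v)`, a Bochner integral in `L²(m)` for each `f`. -/
def weylXD (a : 𝓢(Euc d × Euc d, ℂ)) : L2m d →L[ℂ] L2m d :=
  LinearMap.mkContinuous
    { toFun := fun f => ∫ p : Euc d × Euc d, phaseFourier a p.1 p.2 • expXD p.1 p.2 f
        ∂((lebM d).prod (lebM d))
      map_add' := fun f g => by
        simp only [map_add, smul_add]
        exact integral_add (integrable_weyl a f) (integrable_weyl a g)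
      map_smul' := fun c f => by
        simp only [map_smul, RingHom.id_apply, smul_comm _ c]
        exact integral_smul _ _ }
    (∫ p : Euc d × Euc d, ‖phaseFourier a p.1 p.2‖ ∂((lebM d).prod (lebM d)))
    (fun f => by
      refine (norm_integral_le_integral_norm _).trans (le_of_eq ?_)
      simp only [norm_smul, LinearIsometryEquiv.norm_map]
      exact integral_mul_const _ _)

/-- The Weyl calculus of `(Q, P)` on `L²(γ)`: `a(Q, P) = U⁻¹ ∘ a(X, D) ∘ U`. -/
def weylQP (a : 𝓢(Euc d × Euc d, ℂ)) : L2γ d →L[ℂ] L2γ d :=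
  (unitaryU d).symm.toContinuousLinearEquiv.toContinuousLinearMap ∘L weylXD a ∘L
    (unitaryU d).toContinuousLinearEquiv.toContinuousLinearMap

/-- `a(Q, P) f = ∫∫ â(u, v) exp(i(uQ + vP)) f dm(u) dm(v)`. -/
theorem weylQP_apply (a : 𝓢(Euc d × Euc d, ℂ)) (f : L2γ d) :
    weylQP a f = ∫ p : Euc d × Euc d, phaseFourier a p.1 p.2 • expQP p.1 p.2 f
      ∂((lebM d).prod (lebM d)) := by
  have h := (unitaryU d).symm.toContinuousLinearEquiv.toContinuousLinearMap.integral_comp_comm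
    (integrable_weyl a (unitaryU d f))
  refine h.symm.trans (integral_congr_ae (ae_of_all _ fun p => ?_))
  exact map_smul (unitaryU d).symm _ _

end Spaces

section Operator
variable (d : ℕ)

/-- The space `C_c²(ℝ^d)` of complex-valued test functions. -/
def testFunctions : Submodule ℂ (Euc d → ℂ) where
  carrier := {g | ContDiff ℝ 2 g ∧ HasCompactSupport g}
  add_mem' hf hg := ⟨hf.1.add hg.1, hf.2.add hg.2⟩
  zero_mem' := ⟨contDiff_const, HasCompactSupport.zero⟩
  smul_mem' c _ hf := ⟨hf.1.const_smul c, hf.2.smul_left (f := fun _ => c)⟩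

variable {d}
/-- `L g(x) = -Δ g(x) + x · ∇ g(x)`. -/
def ouDiff (g : Euc d → ℂ) (x : Euc d) : ℂ := -(Laplacian.laplacian g x) + fderiv ℝ g x x

theorem memLp_test {g : Euc d → ℂ} (hg : g ∈ testFunctions d) : MemLp g 2 (gaussM d) :=
  hg.1.continuous.memLp_of_hasCompactSupport hg.2

theorem memLp_ouDiff {g : Euc d → ℂ} (hg : g ∈ testFunctions d) :
    MemLp (ouDiff g) 2 (gaussM d) := by
  have hc : Continuous (ouDiff g) := by
    unfold ouDiff
    refine Continuous.add (Continuous.neg ?_) ?_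
    · rw [InnerProductSpace.laplacian_eq_iteratedFDeriv_stdOrthonormalBasis]
      refine continuous_finsetSum _ fun i _ => ?_
      exact (hg.1.continuous_iteratedFDeriv le_rfl).eval_const _
    · exact (hg.1.continuous_fderiv (by simp)).clm_apply continuous_id
  refine hc.memLp_of_hasCompactSupport (hg.2.mono' fun x hx => ?_)
  by_contra h
  apply hx
  have h1 : g =ᶠ[𝓝 x] fun _ => (0 : ℂ) := notMem_tsupport_iff_eventuallyEq.1 h
  rw [ouDiff, (InnerProductSpace.laplacian_congr_nhds h1).self_of_nhds, h1.fderiv_eq]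
  simp [InnerProductSpace.laplacian_const]

variable (d)
/-- The inclusion `C_c²(ℝ^d) → L²(γ)`. -/
def testToL2 : testFunctions d →ₗ[ℂ] L2γ d where
  toFun g := (memLp_test g.2).toLp _
  map_add' _ _ := rfl
  map_smul' _ _ := rfl

theorem testToL2_injective : Function.Injective (testToL2 d) := by
  intro f g h
  have h' : (f : Euc d → ℂ) =ᵐ[gaussM d] g := (MemLp.toLp_eq_toLp_iff (memLp_test f.2) (memLp_test g.2)).1 h
  exact Subtype.ext (Continuous.ae_eq_iff_eq (gaussM d) f.2.1.continuous g.2.1.continuous |>.1 h')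

/-- `L` on test functions. -/
def ouTest : testFunctions d →ₗ[ℂ] L2γ d where
  toFun g := (memLp_ouDiff g.2).toLp _
  map_add' f g := by
    rw [← MemLp.toLp_add, MemLp.toLp_eq_toLp_iff]
    refine ae_of_all _ fun x => ?_
    have h1 := f.2.1.contDiffAt (x := x)
    have h2 := g.2.1.contDiffAt (x := x)
    simp only [ouDiff, Pi.add_apply, Submodule.coe_add]
    rw [h1.laplacian_add h2, fderiv_add (h1.differentiableAt (by simp))
      (h2.differentiableAt (by simp)), add_apply]
    ring
  map_smul' c g := by
    rw [RingHom.id_apply, ← MemLp.toLp_const_smul, MemLp.toLp_eq_toLp_iff]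
    refine ae_of_all _ fun x => ?_
    have h1 := g.2.1.contDiffAt (x := x)
    simp only [ouDiff, Pi.smul_apply, Submodule.coe_smul, smul_add, smul_neg]
    rw [InnerProductSpace.laplacian_smul c h1,
      fderiv_const_smul (h1.differentiableAt (by simp)), smul_apply]

/-- The Ornstein–Uhlenbeck operator with domain `C_c²(ℝ^d)`. -/
def ouMin : L2γ d →ₗ.[ℂ] L2γ d where
  domain := LinearMap.range (testToL2 d)
  toFun := ouTest d ∘ₗ (LinearEquiv.ofInjective (testToL2 d) (testToL2_injective d)).symm.toLinearMap

/-- The Ornstein–Uhlenbeck operator `L` on `L²(γ)`: the closure of `-Δ + x · ∇` on `C_c²(ℝ^d)`. -/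
def ouOp : L2γ d →ₗ.[ℂ] L2γ d := (ouMin d).closure

end Operator

section Semigroup
variable {H : Type*} [NormedAddCommGroup H] [NormedSpace ℂ H]

/-- `T` is the `C₀`-semigroup of bounded operators whose infinitesimal generator is `A`: the graph of `A` is
the set of all `(f, g)` with `(T(h) f - f) / h → g` as `h ↓ 0`. -/
structure IsC0SemigroupGeneratedBy (A : H →ₗ.[ℂ] H) (T : ℝ≥0 → H →L[ℂ] H) : Prop where
  map_zero : T 0 = 1
  map_add : ∀ r t, T (r + t) = T r * T t
  strong_continuous : ∀ f, Continuous fun t => T t f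
  generator : ∀ f g, (f, g) ∈ A.graph ↔
    Tendsto (fun h : ℝ≥0 => ((h : ℝ) : ℂ)⁻¹ • (T h f - f)) (𝓝[>] 0) (𝓝 g)

open Classical in
/-- `semigroupOf A t = exp(tA)`: the `C₀`-semigroup generated by `A` at time `t` (zero if `A` is not
a generator; a `C₀`-semigroup is determined by its generator, so nothing is chosen here). -/
def semigroupOf (A : H →ₗ.[ℂ] H) : ℝ≥0 → H →L[ℂ] H :=
  if h : ∃ T, IsC0SemigroupGeneratedBy A T then h.choose else 0

end Semigroup

/-- `exp(-zL)` for complex `z`: the time-one value of the `C₀`-semigroup generated by `-zL`. -/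
def expNegL (d : ℕ) (z : ℂ) : L2γ d →L[ℂ] L2γ d := semigroupOf (-(z • ouOp d)) 1

end GaussianWeyl

end

open GaussianWeyl

/-! Diagonalise `L`, then compare the diagonal semigroup with the Weyl calculus on plane waves;
complex `z` is treated directly, without analytic continuation from real time.

Integration by parts against `γ` makes `L` symmetric on test functions, hence closable with
symmetric closure. For a unit vector `θ` the function `He_n(θ·x)` is an eigenvector with eigenvalue
`n` (`hermite_ridge_mem_eigenspace`). The Hermite generating function expands `exp(iqξ·x - (1 -
q²)|ξ|²/2)` as a series `∑ qⁿ vₙ` with `vₙ` in the `n`-th eigenspace and independent of `q`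
(`wave_expansion`). At `q = 1` this is a plane wave, and plane waves are total by injectivity of the
Fourier transform, so `L²(γ)` is the Hilbert sum of the eigenspaces (`isHilbertSum_ouOp`).

A closed symmetric operator with a total set of eigenvectors is the maximal diagonal operator
(`mem_graph_iff_coord`). So `-zL` generates the semigroup with eigenvalues `exp(-znt)`, and no
other, because any semigroup with this generator is forced on eigenvectors. At time one it is the
sum of `exp(-zn) Pₙ`, locally uniformly norm convergent, hence holomorphic. It sends the plane wave
`wave 1 ξ` to `wave (exp(-z)) ξ`.

On the Weyl side the matrix elements of `exp(i(uX + vD))` between images of plane waves are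
Gaussians in `(u, v)`. Integrating them against the Fourier transform of `a_s` gives `(1 + s)^{-d}`
times the matrix element of `wave q ξ` with `q = (1 - s)/(1 + s)` (`inner_weylQP_gaussianSymbol`).
This Möbius map is an involution, so `s = (1 - exp(-z))/(1 + exp(-z))` is exactly the choice with `q
= exp(-z)`. -/

noncomputable section

namespace GaussianWeyl

/-! ### Diagonal operators on a Hilbert sum -/

section Multiplier

/-- Coordinatewise multiplication by a sequence of scalars of modulus at most one, on a Hilbert sum. -/
def lpMultiplier {G : ℕ → Type*} [∀ n, NormedAddCommGroup (G n)] [∀ n, NormedSpace ℂ (G n)]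
    (m : ℕ → ℂ) (hm : ∀ n, ‖m n‖ ≤ 1) : lp G 2 →L[ℂ] lp G 2 :=
  have hle : ∀ (x : lp G 2) n, ‖m n • x n‖ ≤ ‖x n‖ := fun x n => by
    rw [norm_smul]
    exact mul_le_of_le_one_left (norm_nonneg _) (hm n)
  LinearMap.mkContinuous
    { toFun := fun x => ⟨fun n => m n • x n, (lp.memℓp x).mono' (hle x)⟩
      map_add' := fun x y => lp.ext (funext fun n => smul_add (m n) (x n) (y n))
      map_smul' := fun c x => lp.ext (funext fun n => smul_comm (m n) c (x n)) }
    1 (fun x => by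
      rw [one_mul]
      exact lp.norm_mono two_ne_zero (hle x))

theorem lpMultiplier_apply {G : ℕ → Type*} [∀ n, NormedAddCommGroup (G n)]
    [∀ n, NormedSpace ℂ (G n)] (m : ℕ → ℂ) (hm : ∀ n, ‖m n‖ ≤ 1) (x : lp G 2) (n : ℕ) :
    lpMultiplier m hm x n = m n • x n := rfl

/-- Dominated convergence for the series of squared norms, with majorant `4‖x n‖²` since two
multipliers of modulus at most one differ by at most `2`. This gives strong convergence only, which
is what semigroup continuity and generators require. -/
theorem tendsto_lpMultiplier {G : ℕ → Type*} [∀ n, NormedAddCommGroup (G n)]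
    [∀ n, NormedSpace ℂ (G n)] {ι : Type*} {l : Filter ι} {m : ι → ℕ → ℂ} {m' : ℕ → ℂ}
    (hm : ∀ i n, ‖m i n‖ ≤ 1) (hm' : ∀ n, ‖m' n‖ ≤ 1)
    (h : ∀ n, Tendsto (fun i => m i n) l (𝓝 (m' n))) (x : lp G 2) :
    Tendsto (fun i => lpMultiplier (m i) (hm i) x) l (𝓝 (lpMultiplier m' hm' x)) := by
  rw [tendsto_iff_norm_sub_tendsto_zero]
  have key : Tendsto (fun i => ∑' n, ‖(m i n - m' n) • x n‖ ^ 2) l (𝓝 (∑' _ : ℕ, (0 : ℝ))) := by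
    have hs : Summable fun n => 4 * ‖x n‖ ^ 2 := by
      have := (lp.memℓp x).summable (by simp)
      simp only [ENNReal.toReal_ofNat, Real.rpow_ofNat] at this
      exact this.mul_left 4
    refine tendsto_tsum_of_dominated_convergence hs (fun n => ?_) (Eventually.of_forall fun i n => ?_)
    · have h1 : Tendsto (fun i => ‖(m i n - m' n) • x n‖ ^ 2) l
          (𝓝 (‖(m' n - m' n) • x n‖ ^ 2)) :=
        ((((h n).sub_const (m' n)).smul_const (x n)).norm).pow 2
      simpa using h1
    · rw [Real.norm_of_nonneg (by positivity), norm_smul, mul_pow]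
      have : ‖m i n - m' n‖ ≤ 2 := (norm_sub_le _ _).trans (by linarith [hm i n, hm' n])
      gcongr
      nlinarith [norm_nonneg (m i n - m' n)]
  have e : ∀ i, ‖lpMultiplier (m i) (hm i) x - lpMultiplier m' hm' x‖ =
      √(∑' n, ‖(m i n - m' n) • x n‖ ^ 2) := fun i => by
    rw [eq_comm, Real.sqrt_eq_iff_eq_sq (tsum_nonneg fun n => by positivity) (norm_nonneg _)]
    have := lp.norm_rpow_eq_tsum (p := 2) (by simp) (lpMultiplier (m i) (hm i) x - lpMultiplier m' hm' x)
    simp only [ENNReal.toReal_ofNat, Real.rpow_ofNat] at this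
    rw [this]
    refine tsum_congr fun n => ?_
    rw [lp.coeFn_sub, Pi.sub_apply, lpMultiplier_apply, lpMultiplier_apply, sub_smul]
  simp only [e]
  simpa [Function.comp_def] using (Real.continuous_sqrt.tendsto _).comp key

variable {H : Type*} [NormedAddCommGroup H] [InnerProductSpace ℂ H] [CompleteSpace H]
  {E : ℕ → Submodule ℂ H}

/-- The operator acting on the `n`-th summand of a Hilbert sum as multiplication by `m n`. -/
def multiplier (hE : IsHilbertSum ℂ (fun n => E n) fun n => (E n).subtypeₗᵢ)
    (m : ℕ → ℂ) (hm : ∀ n, ‖m n‖ ≤ 1) : H →L[ℂ] H :=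
  hE.linearIsometryEquiv.symm.toContinuousLinearEquiv.toContinuousLinearMap ∘L
    lpMultiplier m hm ∘L hE.linearIsometryEquiv.toContinuousLinearEquiv.toContinuousLinearMap

variable (hE : IsHilbertSum ℂ (fun n => E n) fun n => (E n).subtypeₗᵢ)

theorem multiplier_apply (m : ℕ → ℂ) (hm : ∀ n, ‖m n‖ ≤ 1) (f : H) :
    multiplier hE m hm f = hE.linearIsometryEquiv.symm (lpMultiplier m hm (hE.linearIsometryEquiv f)) :=
  rfl

theorem coord_multiplier (m : ℕ → ℂ) (hm : ∀ n, ‖m n‖ ≤ 1) (f : H) (n : ℕ) :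
    hE.linearIsometryEquiv (multiplier hE m hm f) n = m n • hE.linearIsometryEquiv f n := by
  rw [multiplier_apply, LinearIsometryEquiv.apply_symm_apply, lpMultiplier_apply]

theorem coord_of_mem {n : ℕ} (e : E n) : hE.linearIsometryEquiv (e : H) = lp.single 2 n e := by
  rw [← hE.linearIsometryEquiv.symm.injective.eq_iff, LinearIsometryEquiv.symm_apply_apply,
    hE.linearIsometryEquiv_symm_apply_single]
  rfl

theorem ext_coord {f g : H}
    (h : ∀ n, hE.linearIsometryEquiv f n = hE.linearIsometryEquiv g n) : f = g :=
  hE.linearIsometryEquiv.injective (lp.ext (funext h))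

theorem hasSum_coord (f : H) : HasSum (fun n => (hE.linearIsometryEquiv f n : H)) f := by
  simpa using hE.hasSum_linearIsometryEquiv_symm (hE.linearIsometryEquiv f)

/-- The `n`-th coordinate is the orthogonal projection onto the `n`-th summand; symmetry of an
operator is read off coordinatewise through this. -/
theorem inner_coord {n : ℕ} (e : E n) (f : H) :
    inner ℂ e (hE.linearIsometryEquiv f n) = inner ℂ (e : H) f := by
  rw [← hE.linearIsometryEquiv.inner_map_map, coord_of_mem, lp.inner_single_left]

theorem multiplier_of_mem (m : ℕ → ℂ) (hm : ∀ n, ‖m n‖ ≤ 1) {n : ℕ} {e : H} (he : e ∈ E n) :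
    multiplier hE m hm e = m n • e := by
  refine ext_coord hE fun k => ?_
  rw [coord_multiplier, map_smul, lp.coeFn_smul, Pi.smul_apply, coord_of_mem hE ⟨e, he⟩]
  rcases eq_or_ne k n with rfl | hk
  · rfl
  · rw [lp.single_apply_ne 2 n _ hk, smul_zero, smul_zero]

include hE in
theorem clm_ext_of_hilbertSum {S T : H →L[ℂ] H} (h : ∀ n, ∀ e ∈ E n, S e = T e) : S = T := by
  ext f
  have h1 := (hasSum_coord hE f).mapL S
  have h2 := (hasSum_coord hE f).mapL T
  refine h1.unique ?_
  convert h2 using 2 with n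
  exact h n _ (hE.linearIsometryEquiv f n).2

theorem tendsto_multiplier {ι : Type*} {l : Filter ι} {m : ι → ℕ → ℂ} {m' : ℕ → ℂ}
    (hm : ∀ i n, ‖m i n‖ ≤ 1) (hm' : ∀ n, ‖m' n‖ ≤ 1)
    (h : ∀ n, Tendsto (fun i => m i n) l (𝓝 (m' n))) (f : H) :
    Tendsto (fun i => multiplier hE (m i) (hm i) f) l (𝓝 (multiplier hE m' hm' f)) :=
  (hE.linearIsometryEquiv.symm.continuous.tendsto _).comp (tendsto_lpMultiplier hm hm' h _)

theorem norm_multiplier_le (m : ℕ → ℂ) (hm : ∀ n, ‖m n‖ ≤ 1) : ‖multiplier hE m hm‖ ≤ 1 := by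
  refine ContinuousLinearMap.opNorm_le_bound _ zero_le_one fun f => ?_
  rw [multiplier_apply, LinearIsometryEquiv.norm_map, one_mul,
    ← hE.linearIsometryEquiv.norm_map f]
  refine lp.norm_mono two_ne_zero fun n => ?_
  rw [lpMultiplier_apply, norm_smul]
  exact mul_le_of_le_one_left (norm_nonneg _) (hm n)

theorem norm_cexp_neg_le_one {w : ℂ} (hw : 0 ≤ w.re) (n : ℕ) (t : ℝ≥0) :
    ‖Complex.exp (-(w * n * (t : ℝ)))‖ ≤ 1 := by
  rw [Complex.norm_exp, Real.exp_le_one_iff]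
  simp
  positivity

/-- Mean value inequality on the convex half-plane `Re x ≤ 0`, where the derivative of `exp` has
modulus at most one. It bounds difference quotients of the semigroup uniformly in `n`. -/
theorem norm_cexp_neg_sub_one_le {w : ℂ} (hw : 0 ≤ w.re) : ‖Complex.exp (-w) - 1‖ ≤ ‖w‖ := by
  have hconv : Convex ℝ {x : ℂ | x.re ≤ 0} := convex_halfSpace_re_le 0
  have := hconv.norm_image_sub_le_of_norm_deriv_le (f := Complex.exp) (C := 1) (x := 0) (y := -w)
    (fun x _ => Complex.differentiable_exp x) (fun x hx => by
      rw [Complex.deriv_exp, Complex.norm_exp, Real.exp_le_one_iff]; exact hx) (by simp) (by simpa)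
  simpa using this

/-- The diagonal semigroup with eigenvalue `exp(-znt)` on the `n`-th summand. -/
def diagSemigroup (z : ℂ) (hz : 0 ≤ z.re) (t : ℝ≥0) : H →L[ℂ] H :=
  multiplier hE (fun n => Complex.exp (-(z * n * (t : ℝ)))) fun n => norm_cexp_neg_le_one hz n t

theorem diagSemigroup_of_mem {z : ℂ} (hz : 0 ≤ z.re) (t : ℝ≥0) {n : ℕ} {e : H} (he : e ∈ E n) :
    diagSemigroup hE z hz t e = Complex.exp (-(z * n * (t : ℝ))) • e :=
  multiplier_of_mem hE _ _ he

end Multiplier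

/-! ### Closed symmetric operators with a total set of eigenvectors, and their semigroups -/

section DiagonalGenerator

variable {H : Type*} [NormedAddCommGroup H] [InnerProductSpace ℂ H]

/-- The eigenspace of an unbounded operator. -/
def graphEigenspace (A : H →ₗ.[ℂ] H) (c : ℂ) : Submodule ℂ H :=
  A.graph.comap (LinearMap.id.prod (c • LinearMap.id))

theorem mem_graphEigenspace {A : H →ₗ.[ℂ] H} {c : ℂ} {f : H} :
    f ∈ graphEigenspace A c ↔ (f, c • f) ∈ A.graph := Iff.rfl

theorem isClosed_graphEigenspace {A : H →ₗ.[ℂ] H} (hA : A.IsClosed) (c : ℂ) :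
    IsClosed (graphEigenspace A c : Set H) :=
  IsClosed.preimage (f := fun f : H => (f, c • f)) (by fun_prop) hA

/-- `A` is symmetric: `⟪f, A g⟫ = ⟪A f, g⟫` on the domain of `A`. -/
def IsSymmetricGraph (A : H →ₗ.[ℂ] H) : Prop :=
  ∀ p ∈ A.graph, ∀ q ∈ A.graph, inner ℂ p.1 q.2 = inner ℂ p.2 q.1

theorem orthogonalFamily_graphEigenspace {A : H →ₗ.[ℂ] H} (hA : IsSymmetricGraph A) :
    OrthogonalFamily ℂ (fun n : ℕ => graphEigenspace A n)
      fun n => (graphEigenspace A n).subtypeₗᵢ := by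
  intro i j hij v w
  have h := hA _ (mem_graphEigenspace.1 v.2) _ (mem_graphEigenspace.1 w.2)
  simp only [inner_smul_left, inner_smul_right, map_natCast] at h
  have h' : ((i : ℂ) - j) * inner ℂ (v : H) (w : H) = 0 := by rw [sub_mul, h, sub_self]
  refine (mul_eq_zero.1 h').resolve_left ?_
  exact sub_ne_zero.2 (by exact_mod_cast hij)

theorem mem_graph_neg_smul {A : H →ₗ.[ℂ] H} {z : ℂ} (hz : z ≠ 0) {f g : H} :
    (f, g) ∈ (-(z • A)).graph ↔ (f, -(z⁻¹ • g)) ∈ A.graph := by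
  simp only [LinearPMap.mem_graph_iff, LinearPMap.neg_apply, LinearPMap.smul_apply,
    LinearPMap.neg_domain, LinearPMap.smul_domain]
  refine exists_congr fun y => and_congr_right fun _ => ?_
  constructor
  · rintro rfl
    simp [smul_smul, hz]
  · intro h
    simp [h, smul_smul, hz]

variable [CompleteSpace H] {A : H →ₗ.[ℂ] H}
  (hE : IsHilbertSum ℂ (fun n : ℕ => graphEigenspace A n)
    fun n => (graphEigenspace A n).subtypeₗᵢ)

/-- Symmetry, tested against eigenvectors, determines the coordinates of `g`. Conversely, partial
sums of the coordinate expansions lie in the graph and converge to `(f, g)`, so closedness applies.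
The domain of `A` is thus known without any regularity theory. -/
theorem mem_graph_iff_coord (hA : A.IsClosed) (hs : IsSymmetricGraph A) {f g : H} :
    (f, g) ∈ A.graph ↔
      ∀ n : ℕ, hE.linearIsometryEquiv g n = (n : ℂ) • hE.linearIsometryEquiv f n := by
  constructor
  · intro h n
    refine ext_inner_left ℂ fun e => ?_
    refine (inner_coord hE e g).trans (Eq.trans ?_ (inner_smul_right _ _ _).symm)
    have := hs _ (mem_graphEigenspace.1 e.2) _ h
    rw [inner_smul_left, map_natCast] at this
    exact this.trans (congrArg _ (inner_coord hE e f).symm)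
  · intro h
    have h1 := (hasSum_coord hE f).prodMk (hasSum_coord hE g)
    refine hA.mem_of_tendsto h1 (Eventually.of_forall fun s => ?_)
    refine Submodule.sum_mem _ fun n _ => ?_
    rw [h n]
    exact (hE.linearIsometryEquiv f n).2

theorem smul_sub_self_eq {V : Type*} [AddCommGroup V] [Module ℂ V] (c : ℂ) (v : V) :
    c • v - v = (c - 1) • v := by rw [sub_smul, one_smul]

theorem tendsto_exp_quotient (w : ℂ) :
    Tendsto (fun h : ℝ≥0 => ((h : ℝ) : ℂ)⁻¹ * (Complex.exp (-(w * (h : ℝ))) - 1)) (𝓝[>] 0)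
      (𝓝 (-w)) := by
  have h1 : HasDerivAt (fun x : ℝ => Complex.exp (-(w * x))) (-w) 0 := by
    have : HasDerivAt (fun x : ℝ => -(w * (x : ℂ))) (-w) 0 := by
      simpa using! ((Complex.ofRealCLM.hasDerivAt (x := (0 : ℝ))).const_mul w).neg
    simpa using this.cexp
  have h2 := h1.tendsto_slope_zero_right
  have h3 : Tendsto (fun h : ℝ≥0 => (h : ℝ)) (𝓝[>] 0) (𝓝[>] 0) :=
    tendsto_nhdsWithin_iff.2 ⟨(NNReal.continuous_coe.tendsto' 0 0 rfl).mono_left nhdsWithin_le_nhds,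
      eventually_nhdsWithin_of_forall fun x hx => by simpa using hx⟩
  refine (h2.comp h3).congr fun h => ?_
  simp

/-- For `f` in the domain, the difference quotient is a multiplier of modulus at most one applied to
`g = -zAf`, and this multiplier tends to `1`. In the other direction convergence of each coordinate
already identifies `g`. -/
theorem isC0Semigroup_diagSemigroup (hA : A.IsClosed) (hs : IsSymmetricGraph A) {z : ℂ}
    (hz : 0 < z.re) :
    IsC0SemigroupGeneratedBy (-(z • A)) (diagSemigroup hE z hz.le) where
  map_zero := clm_ext_of_hilbertSum hE fun n e he => by
    rw [diagSemigroup_of_mem hE _ _ he]; simp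
  map_add r t := clm_ext_of_hilbertSum hE fun n e he => by
    rw [mul_apply_eq_comp, diagSemigroup_of_mem hE _ _ he,
      diagSemigroup_of_mem hE _ _ he, map_smul, diagSemigroup_of_mem hE _ _ he, smul_smul,
      ← Complex.exp_add]
    congr 2
    push_cast
    ring
  strong_continuous f := by
    rw [continuous_iff_continuousAt]
    intro t
    refine tendsto_multiplier hE _ _ (fun n => ?_) f
    exact Continuous.tendsto (f := fun t : ℝ≥0 => Complex.exp (-(z * n * (t : ℝ))))
      (by fun_prop) t
  generator f g := by
    have hz0 : z ≠ 0 := by rintro rfl; simp at hz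
    rw [mem_graph_neg_smul hz0, mem_graph_iff_coord hE hA hs]
    constructor
    · intro hfg
      have hfg' : ∀ n, hE.linearIsometryEquiv g n = (-(z * n)) • hE.linearIsometryEquiv f n := by
        intro n
        have := hfg n
        rw [map_neg, map_smul, lp.coeFn_neg, Pi.neg_apply, lp.coeFn_smul, Pi.smul_apply,
          neg_eq_iff_eq_neg, inv_smul_eq_iff₀ hz0] at this
        rw [this, smul_neg, smul_smul, neg_smul]
      -- The ratio of the difference quotient of `exp(-znh)` to its limit `-zn`. At `n = 0` both
      -- vanish, and the value `1` is chosen so that the limit is `1` for every `n`.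
      let c : ℝ≥0 → ℕ → ℂ := fun h n => if n = 0 then 1 else
        -(((h : ℝ) : ℂ)⁻¹ * (Complex.exp (-(z * n * (h : ℝ))) - 1) / (z * n))
      have hc : ∀ h n, ‖c h n‖ ≤ 1 := by
        intro h n
        by_cases hn : n = 0
        · simp [c, hn]
        have hzn : 0 < ‖z * n‖ := by
          rw [norm_pos_iff]; exact mul_ne_zero hz0 (by exact_mod_cast hn)
        simp only [c, hn, if_false, norm_neg, norm_div, norm_mul (_⁻¹)]
        rw [div_le_one hzn, norm_inv, Complex.norm_real, NNReal.norm_eq]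
        have hre : 0 ≤ (z * n * (h : ℝ)).re := by
          simp
          positivity
        have := norm_cexp_neg_sub_one_le hre
        rcases eq_or_ne h 0 with rfl | hh
        · simp
          positivity
        · rw [inv_mul_le_iff₀' (by positivity)]
          simpa [norm_mul] using this
      have h1 : ∀ h : ℝ≥0, 0 < h → ((h : ℝ) : ℂ)⁻¹ • (diagSemigroup hE z hz.le h f - f) =
          multiplier hE (c h) (hc h) g := by
        intro h hh
        refine ext_coord hE fun n => ?_
        rw [map_smul, map_sub, lp.coeFn_smul, Pi.smul_apply, lp.coeFn_sub, Pi.sub_apply,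
          diagSemigroup, coord_multiplier, coord_multiplier, hfg' n, smul_smul, smul_sub_self_eq, smul_smul]
        congr 1
        by_cases hn : n = 0
        · simp [hn]
        · simp only [c, hn, if_false]
          have : z * n ≠ 0 := mul_ne_zero hz0 (by exact_mod_cast hn)
          field_simp
      have h2 : Tendsto (fun h => multiplier hE (c h) (hc h) g) (𝓝[>] 0)
          (𝓝 (multiplier hE (fun _ => 1) (fun _ => by simp) g)) := by
        refine tendsto_multiplier hE _ _ (fun n => ?_) g
        by_cases hn : n = 0
        · simp [c, hn]
        · simp only [c, hn, if_false]
          have hzn : z * n ≠ 0 := mul_ne_zero hz0 (by exact_mod_cast hn)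
          have := ((tendsto_exp_quotient (z * n)).div_const (z * n)).neg
          rwa [neg_div, neg_neg, div_self hzn] at this
      have h3 : multiplier hE (fun _ => 1) (fun _ => by simp) g = g :=
        ext_coord hE fun n => by rw [coord_multiplier, one_smul]
      rw [h3] at h2
      exact h2.congr' (eventually_nhdsWithin_of_forall fun h hh => (h1 h hh).symm)
    · intro h n
      have h1 : Tendsto (fun h : ℝ≥0 => hE.linearIsometryEquiv
          (((h : ℝ) : ℂ)⁻¹ • (diagSemigroup hE z hz.le h f - f)) n) (𝓝[>] 0)
          (𝓝 (hE.linearIsometryEquiv g n)) :=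
        ((lp.evalCLM ℂ (fun n : ℕ => graphEigenspace A n) 2 n).continuous.tendsto _).comp
          ((hE.linearIsometryEquiv.continuous.tendsto _).comp h)
      have h2 : ∀ h : ℝ≥0, hE.linearIsometryEquiv
          (((h : ℝ) : ℂ)⁻¹ • (diagSemigroup hE z hz.le h f - f)) n =
          (((h : ℝ) : ℂ)⁻¹ * (Complex.exp (-(z * n * (h : ℝ))) - 1)) •
            hE.linearIsometryEquiv f n := by
        intro h
        rw [map_smul, map_sub, lp.coeFn_smul, Pi.smul_apply, lp.coeFn_sub, Pi.sub_apply,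
          diagSemigroup, coord_multiplier, smul_sub_self_eq, smul_smul]
      simp only [h2] at h1
      have h3 := tendsto_nhds_unique h1 ((tendsto_exp_quotient (z * n)).smul_const _)
      rw [map_neg, map_smul, lp.coeFn_neg, Pi.neg_apply, lp.coeFn_smul, Pi.smul_apply, h3,
        smul_smul, ← neg_smul]
      congr 1
      field_simp

-- The function `exp(-ct) S(t)e` is continuous with right derivative zero, hence constant. The
-- generator only supplies one-sided derivatives, and these suffice.
omit [CompleteSpace H] in
theorem IsC0SemigroupGeneratedBy.apply_eigenvector {B : H →ₗ.[ℂ] H} {S : ℝ≥0 → H →L[ℂ] H}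
    (hS : IsC0SemigroupGeneratedBy B S) {c : ℂ} {e : H} (he : (e, c • e) ∈ B.graph) (t : ℝ≥0) :
    S t e = Complex.exp (c * (t : ℝ)) • e := by
  have hderiv : ∀ x : ℝ, 0 ≤ x →
      HasDerivWithinAt (fun x : ℝ => S x.toNNReal e) (c • S x.toNNReal e) (Set.Ici x) x := by
    intro x hx
    rw [hasDerivWithinAt_iff_tendsto_slope, Set.Ici_sdiff_left]
    have h1 := (hS.generator _ _).1 he
    have h2 : Tendsto (fun y : ℝ => (y - x).toNNReal) (𝓝[>] x) (𝓝[>] 0) := by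
      refine tendsto_nhdsWithin_iff.2 ⟨?_, eventually_nhdsWithin_of_forall fun y hy => ?_⟩
      · exact (Continuous.tendsto' (by fun_prop) x 0 (by simp)).mono_left nhdsWithin_le_nhds
      · simpa using hy
    have h3 := ((S x.toNNReal).continuous.tendsto _).comp (h1.comp h2)
    rw [map_smul] at h3
    refine h3.congr' (eventually_nhdsWithin_of_forall fun y (hy : x < y) => ?_)
    -- The semigroup law `S(y) - S(x) = S(x)(S(y - x) - 1)` reduces the slope at `x` to the
    -- generator limit at zero.
    have hxy : y.toNNReal = x.toNNReal + (y - x).toNNReal := by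
      rw [← Real.toNNReal_add hx (by linarith), add_sub_cancel]
    simp only [Function.comp_apply, slope, vsub_eq_sub, map_smul, map_sub]
    rw [hxy, hS.map_add, mul_apply_eq_comp, Real.coe_toNNReal _ (by linarith : 0 ≤ y - x),
      ← Complex.coe_smul, Complex.ofReal_inv]
  have hcont : Continuous fun x : ℝ => S x.toNNReal e :=
    (hS.strong_continuous e).comp continuous_real_toNNReal
  have hexp : ∀ x : ℝ, HasDerivAt (fun x : ℝ => Complex.exp (-(c * x))) (-(c * Complex.exp (-(c * x)))) x := by
    intro x
    have : HasDerivAt (fun x : ℝ => -(c * (x : ℂ))) (-c) x := by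
      simpa using! ((Complex.ofRealCLM.hasDerivAt (x := x)).const_mul c).neg
    convert! this.cexp using 1
    ring
  have key := constant_of_has_deriv_right_zero (a := 0) (b := (t : ℝ))
    (f := fun x : ℝ => Complex.exp (-(c * x)) • S x.toNNReal e)
    (((by fun_prop : Continuous fun x : ℝ => Complex.exp (-(c * (x : ℂ)))).smul hcont).continuousOn)
    (fun x hx => by
      convert! (hexp x).hasDerivWithinAt.smul (hderiv x hx.1) using 1
      rw [smul_smul, ← add_smul, mul_comm, add_neg_cancel, zero_smul]) t ⟨t.2, le_rfl⟩
  simp only [Real.toNNReal_coe, Real.toNNReal_zero, hS.map_zero] at key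
  have h4 := congrArg (fun v => Complex.exp (c * (t : ℝ)) • v) key
  simpa [smul_smul, ← Complex.exp_add] using h4

-- Eigenvectors are total and the generator fixes the semigroup on each of them, so uniqueness needs
-- no general theorem on `C₀`-semigroups.
include hE in
theorem IsC0SemigroupGeneratedBy.eq_diagSemigroup {z : ℂ} (hz : 0 < z.re) {S : ℝ≥0 → H →L[ℂ] H}
    (hS : IsC0SemigroupGeneratedBy (-(z • A)) S) : S = diagSemigroup hE z hz.le := by
  have hz0 : z ≠ 0 := by rintro rfl; simp at hz
  funext t
  refine clm_ext_of_hilbertSum hE fun n e he => ?_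
  rw [diagSemigroup_of_mem hE _ _ he, hS.apply_eigenvector (c := -(z * n)) ?_ t, neg_mul]
  rw [mem_graph_neg_smul hz0]
  rw [mem_graphEigenspace] at he
  convert he using 2
  rw [smul_smul, ← neg_smul]
  congr 1
  field_simp

include hE in
theorem existsUnique_semigroup (hA : A.IsClosed) (hs : IsSymmetricGraph A) {z : ℂ}
    (hz : 0 < z.re) : ∃! T : ℝ≥0 → H →L[ℂ] H, IsC0SemigroupGeneratedBy (-(z • A)) T :=
  ⟨_, isC0Semigroup_diagSemigroup hE hA hs hz, fun _ hS => hS.eq_diagSemigroup hE hz⟩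

theorem semigroupOf_eq_diagSemigroup (hA : A.IsClosed) (hs : IsSymmetricGraph A) {z : ℂ}
    (hz : 0 < z.re) : semigroupOf (-(z • A)) = diagSemigroup hE z hz.le := by
  have h : ∃ T, IsC0SemigroupGeneratedBy (-(z • A)) T :=
    ⟨_, isC0Semigroup_diagSemigroup hE hA hs hz⟩
  rw [semigroupOf, dif_pos h]
  exact h.choose_spec.eq_diagSemigroup hE hz

/-- Near `z₀` the operator is the norm-convergent series of `exp(-zn) Pₙ`, with `Pₙ` the spectral
projections; a locally uniform limit of holomorphic functions is holomorphic. -/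
theorem differentiableOn_diagSemigroup (F : ℂ → H →L[ℂ] H)
    (hF : ∀ z (hz : 0 < z.re), F z = diagSemigroup hE z hz.le 1) :
    DifferentiableOn ℂ F {z : ℂ | 0 < z.re} := by
  intro z₀ hz₀
  have hz₀' : 0 < z₀.re := hz₀
  have hp : ∀ n k : ℕ, ‖if k = n then (1 : ℂ) else 0‖ ≤ 1 := fun n k => by split_ifs <;> simp
  let P : ℕ → H →L[ℂ] H := fun n => multiplier hE (fun k => if k = n then 1 else 0) (hp n)
  -- On this half-plane one geometric series, of ratio `exp(-Re z₀/2) < 1`, dominates all terms.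
  let V : Set ℂ := {z | z₀.re / 2 < z.re}
  have hV : IsOpen V := isOpen_lt continuous_const Complex.continuous_re
  have hb : ∀ (n : ℕ) (w : ℂ), w ∈ V →
      ‖Complex.exp (-(w * n)) • P n‖ ≤ Real.exp (-(z₀.re / 2)) ^ n := by
    intro n w hw
    rw [norm_smul, Complex.norm_exp, ← Real.exp_nat_mul]
    refine (mul_le_of_le_one_right (Real.exp_pos _).le (norm_multiplier_le hE _ _)).trans ?_
    rw [Real.exp_le_exp]
    have hw' : z₀.re / 2 < w.re := hw
    have : (n : ℝ) * (z₀.re / 2) ≤ n * w.re := by gcongr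
    simp
    linarith
  have hsum : Summable fun n : ℕ => Real.exp (-(z₀.re / 2)) ^ n :=
    summable_geometric_of_lt_one (Real.exp_pos _).le (Real.exp_lt_one_iff.2 (by linarith))
  have h1 := Complex.differentiableOn_tsum_of_summable_norm hsum
    (F := fun (n : ℕ) (w : ℂ) => Complex.exp (-(w * n)) • P n)
    (fun n => by fun_prop) hV hb
  have h2 : ∀ w ∈ V, F w = ∑' n : ℕ, Complex.exp (-(w * n)) • P n := by
    intro w hw
    have hw0 : 0 < w.re := lt_trans (by linarith : 0 < z₀.re / 2) hw
    have hs : HasSum (fun n : ℕ => Complex.exp (-(w * n)) • P n)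
        (∑' n : ℕ, Complex.exp (-(w * n)) • P n) :=
      (Summable.of_norm_bounded hsum fun n => hb n w hw).hasSum
    rw [hF w hw0]
    refine clm_ext_of_hilbertSum hE fun k e he => ?_
    rw [diagSemigroup_of_mem hE _ _ he]
    have h3 := hs.mapL (ContinuousLinearMap.apply ℂ H e)
    refine HasSum.unique ?_ h3
    convert hasSum_single k fun n hn => ?_ using 1
    · simp [P, multiplier_of_mem hE _ _ he]
    · simp [P, multiplier_of_mem hE _ _ he, hn.symm]
  have hmem : z₀ ∈ V := by
    change z₀.re / 2 < z₀.re
    linarith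
  exact (((h1.congr h2).differentiableAt (hV.mem_nhds hmem))).differentiableWithinAt

end DiagonalGenerator

/-! ### The operator in coordinates and integration by parts -/

section PartialDerivatives

variable {d : ℕ}

/-- The partial derivative in the `i`-th coordinate direction. -/
def pd (i : Fin d) (g : Euc d → ℂ) (x : Euc d) : ℂ :=
  fderiv ℝ g x (EuclideanSpace.basisFun (Fin d) ℝ i)

theorem contDiff_pd {g : Euc d → ℂ} {n m : WithTop ℕ∞} (hg : ContDiff ℝ n g) (hmn : m + 1 ≤ n)
    (i : Fin d) : ContDiff ℝ m (pd i g) :=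
  (hg.fderiv_right hmn).clm_apply contDiff_const

theorem hasCompactSupport_pd {g : Euc d → ℂ} (hg : HasCompactSupport g) (i : Fin d) :
    HasCompactSupport (pd i g) :=
  hg.fderiv_apply (𝕜 := ℝ) _

theorem pd_mul {f g : Euc d → ℂ} {x : Euc d} (hf : DifferentiableAt ℝ f x)
    (hg : DifferentiableAt ℝ g x) (i : Fin d) :
    pd i (fun y => f y * g y) x = f x * pd i g x + pd i f x * g x := by
  rw [pd, fderiv_fun_mul hf hg]
  simp [pd, mul_comm]

theorem pd_add {f g : Euc d → ℂ} {x : Euc d} (hf : DifferentiableAt ℝ f x)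
    (hg : DifferentiableAt ℝ g x) (i : Fin d) :
    pd i (fun y => f y + g y) x = pd i f x + pd i g x := by
  rw [pd, fderiv_fun_add hf hg]
  rfl

theorem pd_conj (f : Euc d → ℂ) (i : Fin d) (x : Euc d) :
    pd i (fun y => (starRingEnd ℂ) (f y)) x = (starRingEnd ℂ) (pd i f x) := by
  have := Complex.conjCLE.comp_fderiv (f := f) (x := x)
  rw [pd]
  change fderiv ℝ (Complex.conjCLE ∘ f) x _ = _
  rw [this]
  rfl

theorem laplacian_eq_sum_pd {g : Euc d → ℂ} (hg : ContDiff ℝ 2 g) (x : Euc d) :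
    Laplacian.laplacian g x = ∑ i, pd i (pd i g) x := by
  rw [InnerProductSpace.laplacian_eq_iteratedFDeriv_orthonormalBasis g
    (EuclideanSpace.basisFun (Fin d) ℝ)]
  refine Finset.sum_congr rfl fun i _ => ?_
  have h : DifferentiableAt ℝ (fderiv ℝ g) x :=
    (hg.fderiv_right (m := 1) (by norm_num)).differentiable (by simp) x
  rw [iteratedFDeriv_two_apply, pd]
  unfold pd
  rw [fderiv_clm_apply h (by fun_prop)]
  simp

theorem fderiv_apply_eq_sum_pd (g : Euc d → ℂ) (x v : Euc d) :
    fderiv ℝ g x v = ∑ i, (v i : ℂ) * pd i g x := by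
  conv_lhs => rw [← (EuclideanSpace.basisFun (Fin d) ℝ).sum_repr v]
  simp [pd]

theorem ouDiff_eq_sum {g : Euc d → ℂ} (hg : ContDiff ℝ 2 g) (x : Euc d) :
    ouDiff g x = ∑ i, (-(pd i (pd i g) x) + (x i : ℂ) * pd i g x) := by
  rw [ouDiff, laplacian_eq_sum_pd hg, fderiv_apply_eq_sum_pd, Finset.sum_add_distrib,
    Finset.sum_neg_distrib]

/-- The unnormalised Gaussian weight `exp(-|x|²/2)`. -/
def gaussWeight (d : ℕ) (x : Euc d) : ℂ := (Real.exp (-‖x‖ ^ 2 / 2) : ℂ)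

theorem contDiff_gaussWeight : ContDiff ℝ ∞ (gaussWeight d) :=
  Complex.ofRealCLM.contDiff.comp (((contDiff_norm_sq ℝ).neg.div_const 2).exp)

theorem pd_gaussWeight (i : Fin d) (x : Euc d) :
    pd i (gaussWeight d) x = -(x i : ℂ) * gaussWeight d x := by
  have h1 : HasFDerivAt (fun y : Euc d => -‖y‖ ^ 2 / 2) (-innerSL ℝ x) x := by
    convert! ((hasStrictFDerivAt_norm_sq x).hasFDerivAt.neg.mul_const (2⁻¹ : ℝ)) using 1
    ext v
    simp
  have h2 := Complex.ofRealCLM.hasFDerivAt.comp x h1.exp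
  have h3 : fderiv ℝ (gaussWeight d) x = _ := h2.fderiv
  rw [pd, h3]
  simp [gaussWeight, mul_comm, EuclideanSpace.inner_single_right]

theorem integral_gaussM (F : Euc d → ℂ) :
    ∫ x, F x ∂(gaussM d) =
      ((2 * Real.pi) ^ (-(d : ℝ) / 2) : ℝ) * ∫ x, gaussWeight d x * F x := by
  rw [gaussM, integral_withDensity_eq_integral_toReal_smul (by fun_prop)
    (ae_of_all _ fun _ => ENNReal.ofReal_lt_top), ← integral_const_mul]
  refine integral_congr_ae (ae_of_all _ fun x => ?_)
  have := lebM_const_pos d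
  beta_reduce
  rw [ENNReal.toReal_ofReal (by positivity), gaussWeight, Complex.real_smul, Complex.ofReal_mul,
    mul_assoc]

/-- Integration by parts for `L`: it is the operator of the Dirichlet form of `γ`. -/
theorem integral_mul_ouDiff {f g : Euc d → ℂ} (hf : ContDiff ℝ 1 f) (hg : ContDiff ℝ 2 g)
    (hfc : HasCompactSupport f) (hgc : HasCompactSupport g) :
    ∫ x, gaussWeight d x * (f x * ouDiff g x) =
      ∑ i, ∫ x, gaussWeight d x * (pd i f x * pd i g x) := by
  have hw : ContDiff ℝ 1 (gaussWeight d) := contDiff_gaussWeight.of_le (by norm_cast)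
  have hpf : ∀ i, Continuous (pd i f) := fun i => (contDiff_pd hf (m := 0) (by simp) i).continuous
  have hpg : ∀ i, ContDiff ℝ 1 (pd i g) := fun i => contDiff_pd hg (by norm_num) i
  have hwp : ∀ i, ContDiff ℝ 1 fun x => gaussWeight d x * pd i g x := fun i => hw.mul (hpg i)
  have hwpc : ∀ i, HasCompactSupport fun x => gaussWeight d x * pd i g x := fun i =>
    (hasCompactSupport_pd hgc i).mul_left
  have hc : ∀ i, Continuous (pd i fun y => gaussWeight d y * pd i g y) := fun i =>
    (contDiff_pd (hwp i) (m := 0) (by simp) i).continuous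
  -- Divergence form: with `w` the Gaussian weight, `∂ᵢw = -xᵢw` gives `w Lg = -∑ ∂ᵢ(w ∂ᵢg)`, which
  -- absorbs the drift.
  have h1 : ∀ x, gaussWeight d x * (f x * ouDiff g x) =
      ∑ i, -(f x * pd i (fun y => gaussWeight d y * pd i g y) x) := by
    intro x
    rw [ouDiff_eq_sum hg, Finset.mul_sum, Finset.mul_sum]
    refine Finset.sum_congr rfl fun i _ => ?_
    rw [pd_mul (hw.differentiable (by simp) x) ((hpg i).differentiable (by simp) x),
      pd_gaussWeight]
    ring
  simp_rw [h1]
  rw [integral_finsetSum]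
  · refine Finset.sum_congr rfl fun i _ => ?_
    rw [integral_neg]
    have := integral_mul_fderiv_eq_neg_fderiv_mul_of_integrable (μ := (volume : Measure (Euc d)))
      (f := f) (g := fun y => gaussWeight d y * pd i g y)
      (v := EuclideanSpace.basisFun (Fin d) ℝ i)
      (((hpf i).mul (hwp i).continuous).integrable_of_hasCompactSupport (hwpc i).mul_left)
      ((hf.continuous.mul (hc i)).integrable_of_hasCompactSupport hfc.mul_right)
      ((hf.continuous.mul (hwp i).continuous).integrable_of_hasCompactSupport hfc.mul_right)
      (fun x _ => hf.differentiable (by simp) x) (fun x _ => (hwp i).differentiable (by simp) x)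
    rw [neg_eq_iff_eq_neg]
    refine this.trans ?_
    congr 1
    refine integral_congr_ae (ae_of_all _ fun x => ?_)
    simp only [pd]
    ring
  · intro i _
    exact ((hf.continuous.mul (hc i)).integrable_of_hasCompactSupport hfc.mul_right).neg

end PartialDerivatives

/-! ### Symmetry and closability -/

section Closure
variable {d : ℕ}

theorem mem_graph_ouMin {p : L2γ d × L2γ d} :
    p ∈ (ouMin d).graph ↔ ∃ g : testFunctions d, p = (testToL2 d g, ouTest d g) := by
  rw [LinearPMap.mem_graph_iff]
  constructor
  · rintro ⟨⟨y, g, rfl⟩, h1, h2⟩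
    refine ⟨g, Prod.ext h1.symm (h2.symm.trans ?_)⟩
    change ouTest d _ = _
    congr 1
    exact (LinearEquiv.symm_apply_eq _).2 rfl
  · rintro ⟨g, rfl⟩
    refine ⟨⟨testToL2 d g, g, rfl⟩, rfl, ?_⟩
    change ouTest d _ = _
    congr 1
    exact (LinearEquiv.symm_apply_eq _).2 rfl

theorem inner_testToL2_ouTest (f g : testFunctions d) :
    inner ℂ (testToL2 d f) (ouTest d g) = ((2 * Real.pi) ^ (-(d : ℝ) / 2) : ℝ) *
      ∑ i, ∫ x, gaussWeight d x * ((starRingEnd ℂ) (pd i f x) * pd i g x) := by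
  rw [L2.inner_def]
  have : ∫ x, inner ℂ (testToL2 d f x) (ouTest d g x) ∂(gaussM d) =
      ∫ x, (starRingEnd ℂ) ((f : Euc d → ℂ) x) * ouDiff g x ∂(gaussM d) := by
    refine integral_congr_ae ?_
    filter_upwards [(memLp_test f.2).coeFn_toLp, (memLp_ouDiff g.2).coeFn_toLp] with x h1 h2
    change inner ℂ ((memLp_test f.2).toLp _ x) ((memLp_ouDiff g.2).toLp _ x) = _
    rw [h1, h2, RCLike.inner_apply, mul_comm]
  rw [this, integral_gaussM, integral_mul_ouDiff (f := fun x => (starRingEnd ℂ) ((f : Euc d → ℂ) x)) (Complex.conjCLE.contDiff.comp (f.2.1.of_le (by norm_num)))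
    g.2.1 (f.2.2.comp_left (g := starRingEnd ℂ) (map_zero _)) g.2.2]
  simp_rw [pd_conj]

theorem isSymmetricGraph_ouMin : IsSymmetricGraph (ouMin d) := by
  intro p hp q hq
  obtain ⟨f, rfl⟩ := mem_graph_ouMin.1 hp
  obtain ⟨g, rfl⟩ := mem_graph_ouMin.1 hq
  change inner ℂ (testToL2 d f) (ouTest d g) = inner ℂ (ouTest d f) (testToL2 d g)
  rw [← inner_conj_symm (ouTest d f), inner_testToL2_ouTest, inner_testToL2_ouTest, map_mul,
    Complex.conj_ofReal, map_sum]
  congr 1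
  refine Finset.sum_congr rfl fun i _ => ?_
  rw [← integral_conj]
  refine integral_congr_ae (ae_of_all _ fun x => ?_)
  beta_reduce
  rw [map_mul, map_mul, Complex.conj_conj, gaussWeight, Complex.conj_ofReal,
    mul_comm (pd i (g : Euc d → ℂ) x)]

theorem dense_testToL2 : Dense (Set.range (testToL2 d)) := by
  refine (Lp.dense_hasCompactSupport_contDiff (F := ℂ) (μ := gaussM d) (p := 2) (by simp)).mono ?_
  rintro f ⟨g, hfg, hc, hg⟩
  have hg' : g ∈ testFunctions d := ⟨hg.of_le (by norm_cast), hc⟩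
  exact ⟨⟨g, hg'⟩, Lp.ext ((memLp_test hg').coeFn_toLp.trans hfg.symm)⟩

/-- The symmetry relation is closed in each variable, so it passes to the closure of the graph one
variable at a time. It is stated for the closure as a set, since it serves to prove that this set is
a graph. -/
theorem inner_closure_graph_ouMin {p q : L2γ d × L2γ d}
    (hp : p ∈ (ouMin d).graph.topologicalClosure) (hq : q ∈ (ouMin d).graph.topologicalClosure) :
    inner ℂ p.1 q.2 = inner ℂ p.2 q.1 := by
  have h1 : ∀ a ∈ (ouMin d).graph, ∀ b ∈ (ouMin d).graph.topologicalClosure,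
      inner ℂ a.1 b.2 = inner ℂ a.2 b.1 := fun a ha b hb =>
    closure_minimal (fun b hb => isSymmetricGraph_ouMin a ha b hb)
      (isClosed_eq (f := fun b : L2γ d × L2γ d => inner ℂ a.1 b.2) (by fun_prop) (by fun_prop)) hb
  exact closure_minimal (fun a ha => h1 a ha q hq)
    (isClosed_eq (f := fun a : L2γ d × L2γ d => inner ℂ a.1 q.2) (by fun_prop) (by fun_prop)) hp

/-- If `(0, h)` is a limit of points of the graph, symmetry makes `h` orthogonal to all test
functions, which are dense. -/
theorem isClosable_ouMin : (ouMin d).IsClosable := by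
  refine ⟨(ouMin d).graph.topologicalClosure.toLinearPMap,
    (Submodule.toLinearPMap_graph_eq _ fun p hp hp1 => ?_).symm⟩
  have : ∀ f : L2γ d, inner ℂ f p.2 = 0 := by
    refine fun f => dense_testToL2.induction ?_ (isClosed_eq (by fun_prop) continuous_const) f
    rintro _ ⟨g, rfl⟩
    have hg : (testToL2 d g, ouTest d g) ∈ (ouMin d).graph := mem_graph_ouMin.2 ⟨g, rfl⟩
    have := inner_closure_graph_ouMin (Submodule.le_topologicalClosure _ hg) hp
    simpa [hp1] using this
  exact inner_self_eq_zero.1 (this p.2)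

theorem graph_ouOp : (ouOp d).graph = (ouMin d).graph.topologicalClosure :=
  isClosable_ouMin.graph_closure_eq_closure_graph.symm

theorem isClosed_ouOp : (ouOp d).IsClosed := isClosable_ouMin.closure_isClosed

theorem isSymmetricGraph_ouOp : IsSymmetricGraph (ouOp d) := fun _ hp _ hq =>
  inner_closure_graph_ouMin (graph_ouOp (d := d) ▸ hp) (graph_ouOp (d := d) ▸ hq)

theorem testToL2_mem_graph_ouOp (g : testFunctions d) :
    (testToL2 d g, ouTest d g) ∈ (ouOp d).graph := by
  rw [graph_ouOp]
  exact Submodule.le_topologicalClosure _ (mem_graph_ouMin.2 ⟨g, rfl⟩)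

end Closure

/-! ### Convergence and integrability in `L²(γ)` -/

section GaussianLp
variable {d : ℕ}

/-- Dominated convergence in `L²`. A countably generated filter covers both sequences of cutoffs and
the net of finite partial sums of a series indexed by `ℕ`. -/
theorem tendsto_toLp_of_dominated {α ι : Type*} [MeasurableSpace α] {μ : Measure α} {l : Filter ι}
    [l.IsCountablyGenerated] {F : ι → α → ℂ} {f : α → ℂ} {bound : α → ℝ}
    (hF : ∀ k, MemLp (F k) 2 μ) (hf : MemLp f 2 μ) (hb : MemLp bound 2 μ)
    (hle : ∀ k x, ‖F k x‖ ≤ bound x) (hlim : ∀ x, Tendsto (fun k => F k x) l (𝓝 (f x))) :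
    Tendsto (fun k => (hF k).toLp) l (𝓝 hf.toLp) := by
  rcases l.eq_or_neBot with rfl | hl
  · exact tendsto_bot
  have hfle : ∀ x, ‖f x‖ ≤ bound x := fun x =>
    le_of_tendsto (hlim x).norm (Eventually.of_forall fun k => hle k x)
  rw [Lp.tendsto_Lp_iff_tendsto_eLpNorm'']
  have e : ∀ k, eLpNorm (F k - f) 2 μ = (∫⁻ x, ‖F k x - f x‖ₑ ^ 2 ∂μ) ^ ((1 : ℝ) / 2) := by
    intro k
    rw [eLpNorm_eq_lintegral_rpow_enorm_toReal (by simp) (by simp)]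
    simp
  have key : Tendsto (fun k => ∫⁻ x, ‖F k x - f x‖ₑ ^ 2 ∂μ) l (𝓝 (∫⁻ _, 0 ∂μ)) := by
    refine tendsto_lintegral_filter_of_dominated_convergence' (fun x => 4 * ‖bound x‖ₑ ^ 2) ?_ ?_ ?_ ?_
    · exact Eventually.of_forall fun k =>
        ((hF k).1.sub hf.1).enorm.pow_const 2
    · refine Eventually.of_forall fun k => ae_of_all _ fun x => ?_
      have h1 : ‖F k x - f x‖ ≤ ‖2 * bound x‖ := by
        refine (norm_sub_le _ _).trans (le_trans ?_ (le_abs_self _))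
        linarith [hle k x, hfle x]
      calc ‖F k x - f x‖ₑ ^ 2 ≤ ‖2 * bound x‖ₑ ^ 2 := by
            gcongr
            exact enorm_le_iff_norm_le.2 h1
        _ = 4 * ‖bound x‖ₑ ^ 2 := by
            rw [enorm_mul, mul_pow]
            congr 1
            rw [← ofReal_norm, Real.norm_of_nonneg zero_le_two]
            norm_num
    · have h2 := lintegral_rpow_enorm_lt_top_of_eLpNorm_lt_top (by simp) (by simp) hb.2
      simp only [ENNReal.toReal_ofNat, ENNReal.rpow_ofNat] at h2
      rw [lintegral_const_mul' _ _ (by simp)]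
      exact ENNReal.mul_ne_top (by simp) h2.ne
    · refine ae_of_all _ fun x => ?_
      have h3 : Tendsto (fun k => ‖F k x - f x‖ₑ ^ 2) l (𝓝 (‖f x - f x‖ₑ ^ 2)) :=
        (ENNReal.continuous_pow 2).tendsto _ |>.comp (((hlim x).sub_const (f x)).enorm)
      simpa using h3
  simp only [e]
  have := ((ENNReal.continuous_rpow_const (y := (1 : ℝ) / 2)).tendsto _).comp key
  simpa [Function.comp_def] using this

theorem memLp_exp_norm (K : ℝ) : MemLp (fun x : Euc d => Real.exp (K * ‖x‖)) 2 (gaussM d) := by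
  have hc : Continuous fun x : Euc d => Real.exp (K * ‖x‖) := by fun_prop
  rw [memLp_two_iff_integrable_sq hc.aestronglyMeasurable, gaussM,
    integrable_withDensity_iff_integrable_smul' (by fun_prop)
      (ae_of_all _ fun _ => ENNReal.ofReal_lt_top)]
  have h1 : Integrable (fun x : Euc d => Real.exp (-(4⁻¹ * ‖x‖ ^ 2))) := by
    have := (GaussianFourier.integrable_cexp_neg_mul_sq_norm_add (V := Euc d) (b := 4⁻¹)
      (by norm_num) 0 0).norm
    refine this.congr (ae_of_all _ fun x => ?_)
    simp only [Complex.norm_exp]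
    congr 1
    simp [← Complex.ofReal_pow]
  have h0 := lebM_const_pos d
  refine Integrable.mono' (h1.const_mul ((2 * Real.pi) ^ (-(d : ℝ) / 2) * Real.exp (4 * K ^ 2)))
    (by fun_prop) (ae_of_all _ fun x => ?_)
  rw [ENNReal.toReal_ofReal (by positivity), smul_eq_mul, Real.norm_of_nonneg (by positivity),
    mul_assoc, mul_assoc, ← Real.exp_nat_mul, ← Real.exp_add, ← Real.exp_add]
  refine mul_le_mul_of_nonneg_left (Real.exp_le_exp.2 ?_) h0.le
  push_cast
  -- `2K|x| - |x|²/2 ≤ 4K² - |x|²/4` is `(4K - |x|)² ≥ 0`; the remaining `-|x|²/4` keeps the bound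
  -- integrable.
  nlinarith [sq_nonneg (4 * K - ‖x‖)]

theorem memLp_of_norm_le_exp {f : Euc d → ℂ} (hf : Continuous f) {C K : ℝ}
    (h : ∀ x, ‖f x‖ ≤ C * Real.exp (K * ‖x‖)) : MemLp f 2 (gaussM d) :=
  ((memLp_exp_norm K).const_mul C).mono' hf.aestronglyMeasurable (ae_of_all _ h)

end GaussianLp

/-! ### Extending the domain beyond compact support -/

section Cutoff
variable {d : ℕ}

/-- A smooth function on `ℝ^d` of compact support, equal to one on the unit ball. -/
def cutoff (d : ℕ) (x : Euc d) : ℂ :=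
  ((⟨1, 2, one_pos, one_lt_two⟩ : ContDiffBump (0 : Euc d)) x : ℂ)

theorem contDiff_cutoff : ContDiff ℝ ∞ (cutoff d) :=
  Complex.ofRealCLM.contDiff.comp (ContDiffBump.contDiff _)

theorem hasCompactSupport_cutoff : HasCompactSupport (cutoff d) :=
  (ContDiffBump.hasCompactSupport _).comp_left (g := ((↑) : ℝ → ℂ)) Complex.ofReal_zero

theorem cutoff_eq_one {x : Euc d} (hx : ‖x‖ ≤ 1) : cutoff d x = 1 := by
  rw [cutoff, ContDiffBump.one_of_mem_closedBall _ (by simpa using hx), Complex.ofReal_one]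

theorem norm_cutoff_le_one (x : Euc d) : ‖cutoff d x‖ ≤ 1 := by
  rw [cutoff, Complex.norm_real, Real.norm_of_nonneg (ContDiffBump.nonneg _)]
  exact ContDiffBump.le_one _

theorem pd_comp_smul {f : Euc d → ℂ} (r : ℝ) (i : Fin d) (x : Euc d) :
    pd i (fun y => f (r • y)) x = r * pd i f (r • x) := by
  rw [pd, fderiv_comp_smul]
  simp [pd]

theorem exists_bound_pd {f : Euc d → ℂ} (hf : ContDiff ℝ 1 f) (hfc : HasCompactSupport f) :
    ∃ C, ∀ i x, ‖pd i f x‖ ≤ C := by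
  obtain ⟨C, hC⟩ := (hf.continuous_fderiv (by simp)).bounded_above_of_compact_support
    (hfc.fderiv (𝕜 := ℝ))
  refine ⟨C, fun i x => (ContinuousLinearMap.le_opNorm _ _).trans ?_⟩
  simpa using hC x

/-- Leibniz rule. For `0 ≤ r ≤ 1` the error terms are dominated independently of `r`; the drift term
costs a factor `|x|`, whence the weighted integrability condition in `toLp_mem_graph_ouOp`. -/
theorem ouDiff_cutoff_mul {p : Euc d → ℂ} (hp : ContDiff ℝ 2 p) (r : ℝ) (x : Euc d) :
    ouDiff (fun y => cutoff d (r • y) * p y) x = cutoff d (r • x) * ouDiff p x +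
      ∑ i, (-(2 * (r * pd i (cutoff d) (r • x)) * pd i p x) -
        r ^ 2 * pd i (pd i (cutoff d)) (r • x) * p x +
        x i * (r * pd i (cutoff d) (r • x)) * p x) := by
  have hχ0 : ContDiff ℝ ∞ fun y : Euc d => cutoff d (r • y) :=
    contDiff_cutoff.comp (contDiff_const_smul r)
  have hχ : ContDiff ℝ 2 fun y : Euc d => cutoff d (r • y) := hχ0.of_le (by norm_cast)
  have h1 : ∀ i, pd i (fun y => cutoff d (r • y) * p y) = fun y =>
      cutoff d (r • y) * pd i p y + pd i (fun y => cutoff d (r • y)) y * p y := fun i => by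
    funext y
    exact pd_mul (hχ.differentiable (by simp) y) (hp.differentiable (by simp) y) i
  have h2 : ∀ i, pd i (pd i (fun y => cutoff d (r • y) * p y)) x =
      cutoff d (r • x) * pd i (pd i p) x + 2 * (r * pd i (cutoff d) (r • x)) * pd i p x +
        r ^ 2 * pd i (pd i (cutoff d)) (r • x) * p x := by
    intro i
    have hp1 : ContDiff ℝ 1 (pd i p) := contDiff_pd hp (by norm_num) i
    have hχ1 : ContDiff ℝ 1 (pd i fun y => cutoff d (r • y)) := contDiff_pd hχ (by norm_num) i
    have d0 := hχ.differentiable (by simp) x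
    have d1 := hp.differentiable (by simp) x
    have d2 := hp1.differentiable (by simp) x
    have d3 := hχ1.differentiable (by simp) x
    have h3 : pd i (fun y => cutoff d (r • y)) = fun y => r * pd i (cutoff d) (r • y) := by
      funext y; exact pd_comp_smul r i y
    have h4 : pd i (pd i fun y => cutoff d (r • y)) x =
        r ^ 2 * pd i (pd i (cutoff d)) (r • x) := by
      have d4 : Differentiable ℝ (pd i (cutoff d)) :=
        (contDiff_pd (contDiff_cutoff (d := d)) (m := 1) (by norm_cast) i).differentiable (by simp)
      rw [h3, pd_mul (by fun_prop) (by fun_prop), pd_comp_smul]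
      simp [pd]
      ring
    rw [h1, pd_add (by fun_prop) (by fun_prop), pd_mul d0 d2, pd_mul d3 d1, h4, pd_comp_smul]
    ring
  rw [ouDiff_eq_sum (hχ.mul hp), ouDiff_eq_sum hp, Finset.mul_sum, ← Finset.sum_add_distrib]
  refine Finset.sum_congr rfl fun i _ => ?_
  rw [h2, h1]
  beta_reduce
  rw [pd_comp_smul]
  ring

/-- A `C²` function that is square integrable together with its derivatives lies in the domain of
the closure of `L` on test functions. -/
theorem toLp_mem_graph_ouOp {p : Euc d → ℂ} (hp : ContDiff ℝ 2 p) (h0 : MemLp p 2 (gaussM d))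
    (hx : MemLp (fun x => (1 + ‖x‖) * ‖p x‖) 2 (gaussM d))
    (h1 : ∀ i, MemLp (pd i p) 2 (gaussM d)) (h2 : MemLp (ouDiff p) 2 (gaussM d)) :
    (h0.toLp, h2.toLp) ∈ (ouOp d).graph := by
  let r : ℕ → ℝ := fun k => (k + 1 : ℝ)⁻¹
  have hr0 : ∀ k, 0 < r k := fun k => by positivity
  have hr1 : ∀ k, r k ≤ 1 := fun k => inv_le_one_of_one_le₀ (by simp)
  have hmem : ∀ k, (fun y => cutoff d (r k • y) * p y) ∈ testFunctions d := fun k =>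
    ⟨ContDiff.mul (((contDiff_cutoff.comp (contDiff_const_smul (r k))).of_le
      (by norm_cast) : ContDiff ℝ 2 _)) hp,
      (hasCompactSupport_cutoff.comp_smul (hr0 k).ne').mul_right⟩
  obtain ⟨C₁, hC₁⟩ := exists_bound_pd (contDiff_cutoff (d := d) |>.of_le (by norm_cast))
    hasCompactSupport_cutoff
  have hC₂ : ∀ i : Fin d, ∃ C, ∀ x, ‖pd i (pd i (cutoff d)) x‖ ≤ C := fun i =>
    (exists_bound_pd (contDiff_pd contDiff_cutoff (by norm_cast) i)
      (hasCompactSupport_pd hasCompactSupport_cutoff i)).imp fun C hC => hC i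
  choose C₂ hC₂ using hC₂
  -- Eventually the truncation equals `p` on a whole neighbourhood of `x`, so all derivatives at `x`
  -- agree and the pointwise limits are trivial.
  have hone : ∀ x : Euc d, ∀ᶠ k in atTop, (fun y => cutoff d (r k • y) * p y) =ᶠ[𝓝 x] p := by
    intro x
    obtain ⟨N, hN⟩ := exists_nat_gt ‖x‖
    filter_upwards [eventually_ge_atTop N] with k hk
    have hlt : ‖x‖ < k + 1 := by
      have : (N : ℝ) ≤ k := by exact_mod_cast hk
      linarith
    filter_upwards [(isOpen_lt continuous_norm continuous_const).mem_nhds hlt] with y hy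
    have : ‖r k • y‖ ≤ 1 := by
      rw [norm_smul, Real.norm_of_nonneg (hr0 k).le, inv_mul_le_one₀ (by positivity)]
      exact le_of_lt hy
    rw [cutoff_eq_one this, one_mul]
  have hnorm : ∀ k (x : Euc d), ‖cutoff d (r k • x) * p x‖ ≤ ‖p x‖ := fun k x => by
    rw [norm_mul]
    exact mul_le_of_le_one_left (norm_nonneg _) (norm_cutoff_le_one _)
  have t1 : Tendsto (fun k => testToL2 d ⟨_, hmem k⟩) atTop (𝓝 h0.toLp) :=
    tendsto_toLp_of_dominated (fun k => memLp_test (hmem k)) h0 h0.norm hnorm fun x =>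
      tendsto_const_nhds.congr' ((hone x).mono fun k hk => hk.self_of_nhds.symm)
  have t2 : Tendsto (fun k => ouTest d ⟨_, hmem k⟩) atTop (𝓝 h2.toLp) := by
    refine tendsto_toLp_of_dominated (fun k => memLp_ouDiff (hmem k)) h2
      (bound := fun x => ‖ouDiff p x‖ + ∑ i, ((2 * C₁) * ‖pd i p x‖ +
        (C₂ i + C₁) * ((1 + ‖x‖) * ‖p x‖))) ?_ ?_ ?_
    · exact h2.norm.add (memLp_finsetSum _ fun i _ =>
        ((h1 i).norm.const_mul _).add (hx.const_mul _))
    · intro k x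
      rw [ouDiff_cutoff_mul hp]
      refine (norm_add_le _ _).trans (add_le_add ?_ ((norm_sum_le _ _).trans
        (Finset.sum_le_sum fun i _ => ?_)))
      · rw [norm_mul]
        exact mul_le_of_le_one_left (norm_nonneg _) (norm_cutoff_le_one _)
      · have hC₁0 : 0 ≤ C₁ := (norm_nonneg _).trans (hC₁ i 0)
        have hC₂0 : 0 ≤ C₂ i := (norm_nonneg _).trans (hC₂ i 0)
        have hxi : ‖(x i : ℂ)‖ ≤ ‖x‖ := by
          rw [Complex.norm_real]; exact PiLp.norm_apply_le x i
        have hrn : ‖(r k : ℂ)‖ ≤ 1 := by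
          rw [Complex.norm_real, Real.norm_of_nonneg (hr0 k).le]; exact hr1 k
        have b1 : ‖(r k : ℂ) * pd i (cutoff d) (r k • x)‖ ≤ C₁ := by
          rw [norm_mul]
          exact (mul_le_of_le_one_left (norm_nonneg _) hrn).trans (hC₁ i _)
        have b2 : ‖(r k : ℂ) ^ 2 * pd i (pd i (cutoff d)) (r k • x)‖ ≤ C₂ i := by
          rw [norm_mul, norm_pow]
          exact (mul_le_of_le_one_left (norm_nonneg _) (pow_le_one₀ (norm_nonneg _) hrn)).trans
            (hC₂ i _)
        calc _ ≤ 2 * C₁ * ‖pd i p x‖ + C₂ i * ‖p x‖ + ‖x‖ * C₁ * ‖p x‖ := by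
              refine (norm_add_le _ _).trans (add_le_add ((norm_sub_le _ _).trans
                (add_le_add ?_ ?_)) ?_)
              · rw [norm_neg, norm_mul, norm_mul, Complex.norm_ofNat]
                gcongr
              · rw [norm_mul]
                gcongr
              · rw [norm_mul, norm_mul]
                gcongr
          _ ≤ _ := by
              nlinarith [mul_nonneg hC₁0 (norm_nonneg (p x)),
                mul_nonneg (mul_nonneg hC₂0 (norm_nonneg x)) (norm_nonneg (p x))]
    · intro x
      refine tendsto_const_nhds.congr' ((hone x).mono fun k hk => ?_)
      change -_ + _ = -_ + _
      rw [(InnerProductSpace.laplacian_congr_nhds hk).self_of_nhds, hk.fderiv_eq]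
  exact isClosed_ouOp.mem_of_tendsto (t1.prodMk_nhds t2)
    (Eventually.of_forall fun k => testToL2_mem_graph_ouOp _)

end Cutoff

/-! ### Hermite polynomials and their ridge functions -/

section HermiteRidge

open Polynomial

variable {d : ℕ}

theorem derivative_hermite_succ (n : ℕ) :
    derivative (hermite (n + 1)) = (n + 1 : ℤ[X]) * hermite n := by
  induction n with
  | zero => simp
  | succ n ih =>
    rw [hermite_succ (n + 1), derivative_sub, derivative_mul, derivative_X, one_mul, ih,
      derivative_mul, hermite_succ n]
    simp
    ring

/-- The lowering relation `He'_{n+1} = (n+1) He_n` turns the recurrence `He_{n+1} = X He_n - He'_n`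
into the one-dimensional eigenvalue equation. -/
theorem hermite_differential_equation (n : ℕ) :
    X * derivative (hermite n) - derivative (derivative (hermite n)) = (n : ℤ[X]) * hermite n := by
  cases n with
  | zero => simp
  | succ n =>
    rw [derivative_hermite_succ, derivative_mul, hermite_succ n]
    simp
    ring

/-- The Hermite polynomials (of the probabilists) with complex coefficients. -/
def hermiteC (n : ℕ) : ℂ[X] := (hermite n).map (Int.castRingHom ℂ)

theorem hermiteC_succ (n : ℕ) : hermiteC (n + 1) = X * hermiteC n - derivative (hermiteC n) := by
  rw [hermiteC, hermite_succ, Polynomial.map_sub, Polynomial.map_mul, map_X, ← derivative_map,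
    hermiteC]

theorem hermiteC_differential_equation (n : ℕ) :
    X * derivative (hermiteC n) - derivative (derivative (hermiteC n)) = (n : ℂ[X]) * hermiteC n := by
  have := congrArg (Polynomial.map (Int.castRingHom ℂ)) (hermite_differential_equation n)
  simpa [hermiteC, derivative_map] using this

/-- Each derivative in `τ` acts on the polynomial factor by `P ↦ XP - P'`, the Hermite recurrence.
At `τ = 0` this yields both the Taylor coefficients and Cauchy estimates for them. -/
theorem iteratedDeriv_hermite_generating (t : ℂ) (n : ℕ) :
    iteratedDeriv n (fun τ => Complex.exp (τ * t - τ ^ 2 / 2)) =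
      fun τ => (hermiteC n).eval (t - τ) * Complex.exp (τ * t - τ ^ 2 / 2) := by
  induction n with
  | zero => funext τ; simp [hermiteC]
  | succ n ih =>
    rw [iteratedDeriv_succ, ih]
    funext τ
    have h1 : HasDerivAt (fun τ : ℂ => (hermiteC n).eval (t - τ))
        (-(derivative (hermiteC n)).eval (t - τ)) τ := by
      simpa using! ((hermiteC n).hasDerivAt (t - τ)).comp τ ((hasDerivAt_id τ).const_sub t)
    have h2 : HasDerivAt (fun τ : ℂ => Complex.exp (τ * t - τ ^ 2 / 2))
        (Complex.exp (τ * t - τ ^ 2 / 2) * (t - τ)) τ := by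
      refine HasDerivAt.cexp ?_
      convert! ((hasDerivAt_id τ).mul_const t).sub ((hasDerivAt_pow 2 τ).div_const 2) using 1
      simp
    rw [(h1.fun_mul h2).deriv, hermiteC_succ]
    simp
    ring

theorem hasSum_hermite_generating (t τ : ℂ) :
    HasSum (fun n : ℕ => τ ^ n / (n.factorial : ℂ) * (hermiteC n).eval t)
      (Complex.exp (τ * t - τ ^ 2 / 2)) := by
  have h := Complex.hasSum_taylorSeries_of_entire
    (f := fun τ => Complex.exp (τ * t - τ ^ 2 / 2)) (by fun_prop) 0 τ
  convert! h using 2 with n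
  rw [iteratedDeriv_hermite_generating]
  simp
  ring

/-- Cauchy's estimate for the generating function on the circle `|τ| = R`. The radius stays free, to
make the generating series geometric at any prescribed parameter. -/
theorem norm_hermiteC_eval_le (t : ℂ) (n : ℕ) {R : ℝ} (hR : 0 < R) :
    ‖(hermiteC n).eval t‖ ≤ n.factorial * Real.exp (R * ‖t‖ + R ^ 2 / 2) / R ^ n := by
  have h := Complex.norm_iteratedDeriv_le_of_forall_mem_sphere_norm_le
    (f := fun τ => Complex.exp (τ * t - τ ^ 2 / 2)) (c := 0) (R := R)
    (C := Real.exp (R * ‖t‖ + R ^ 2 / 2)) n hR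
    (Differentiable.diffContOnCl (by fun_prop)) (fun τ hτ => by
      have hτ' : ‖τ‖ = R := by simpa using hτ
      refine (Complex.norm_exp_le_exp_norm _).trans (Real.exp_le_exp.2 ?_)
      refine (norm_sub_le _ _).trans (le_of_eq ?_)
      simp [hτ'])
  rw [iteratedDeriv_hermite_generating] at h
  simpa using h

/-- A polynomial in the linear form `x ↦ θ · x`. -/
def ridge (P : ℂ[X]) (θ x : Euc d) : ℂ := P.eval ((inner ℝ θ x : ℝ) : ℂ)

theorem contDiff_ridge (P : ℂ[X]) (θ : Euc d) {n : WithTop ℕ∞} : ContDiff ℝ n (ridge P θ) := by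
  have h1 : ContDiff ℝ n fun t : ℂ => P.eval t := by
    simpa using! (P.contDiff_aeval (𝕜 := ℂ) n).restrict_scalars ℝ
  exact h1.comp (Complex.ofRealCLM.contDiff.comp (innerSL ℝ θ).contDiff)

theorem pd_ridge (P : ℂ[X]) (θ : Euc d) (i : Fin d) :
    pd i (ridge P θ) = fun x => (θ i : ℂ) * ridge (derivative P) θ x := by
  funext x
  have h1 : HasFDerivAt (fun x : Euc d => ((inner ℝ θ x : ℝ) : ℂ))
      (Complex.ofRealCLM ∘L innerSL ℝ θ) x :=
    (Complex.ofRealCLM ∘L innerSL ℝ θ).hasFDerivAt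
  have h2 : HasFDerivAt (ridge P θ) _ x := (P.hasDerivAt _).comp_hasFDerivAt x h1
  rw [pd, h2.fderiv]
  simp [ridge, mul_comm, EuclideanSpace.inner_single_right]

/-- On functions of `θ·x` the operator becomes one-dimensional; the Laplacian contributes `|θ|²`,
which is why unit vectors give Hermite eigenfunctions. -/
theorem ouDiff_ridge (P : ℂ[X]) (θ x : Euc d) :
    ouDiff (ridge P θ) x = ridge (X * derivative P) θ x -
      ((‖θ‖ ^ 2 : ℝ) : ℂ) * ridge (derivative (derivative P)) θ x := by
  have hpp : ∀ i, pd i (pd i (ridge P θ)) x =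
      (θ i : ℂ) ^ 2 * ridge (derivative (derivative P)) θ x := by
    intro i
    rw [pd_ridge, pd_mul (by fun_prop) ((contDiff_ridge _ _ (n := 1)).differentiable (by simp) x),
      pd_ridge]
    simp [pd]
    ring
  rw [ouDiff_eq_sum (contDiff_ridge P θ)]
  simp only [hpp]
  rw [Finset.sum_add_distrib, Finset.sum_neg_distrib, ← Finset.sum_mul, EuclideanSpace.real_norm_sq_eq]
  have : ∑ i, (x i : ℂ) * pd i (ridge P θ) x = ridge (X * derivative P) θ x := by
    simp only [pd_ridge]
    simp only [ridge, eval_mul, eval_X, PiLp.inner_apply, RCLike.inner_apply, conj_trivial,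
      Complex.ofReal_sum, Complex.ofReal_mul, Finset.sum_mul, mul_assoc]
  rw [this]
  push_cast
  ring

theorem exists_norm_eval_le_exp (P : ℂ[X]) : ∃ C, ∀ t : ℂ, ‖P.eval t‖ ≤ C * Real.exp ‖t‖ := by
  induction P using Polynomial.induction_on' with
  | add P Q hP hQ =>
    obtain ⟨C, hC⟩ := hP
    obtain ⟨D, hD⟩ := hQ
    refine ⟨C + D, fun t => ?_⟩
    rw [eval_add, add_mul]
    exact (norm_add_le _ _).trans (add_le_add (hC t) (hD t))
  | monomial n a =>
    refine ⟨‖a‖ * n.factorial, fun t => ?_⟩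
    rw [eval_monomial, norm_mul, norm_pow, mul_assoc]
    gcongr
    have := Real.pow_div_factorial_le_exp ‖t‖ (norm_nonneg t) n
    rwa [div_le_iff₀' (by positivity)] at this

theorem exists_norm_ridge_le_exp (P : ℂ[X]) (θ : Euc d) :
    ∃ C, 0 ≤ C ∧ ∀ x, ‖ridge P θ x‖ ≤ C * Real.exp (‖θ‖ * ‖x‖) := by
  obtain ⟨C, hC⟩ := exists_norm_eval_le_exp P
  have hC0 : 0 ≤ C := by simpa using (norm_nonneg _).trans (hC 0)
  refine ⟨C, hC0, fun x => (hC _).trans ?_⟩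
  gcongr
  rw [Complex.norm_real]
  exact norm_inner_le_norm θ x

theorem memLp_ridge (P : ℂ[X]) (θ : Euc d) : MemLp (ridge P θ) 2 (gaussM d) := by
  obtain ⟨C, -, hC⟩ := exists_norm_ridge_le_exp P θ
  exact memLp_of_norm_le_exp (contDiff_ridge P θ (n := 0)).continuous hC

theorem memLp_ouDiff_ridge (P : ℂ[X]) (θ : Euc d) : MemLp (ouDiff (ridge P θ)) 2 (gaussM d) := by
  have : ouDiff (ridge P θ) = _ := funext (ouDiff_ridge P θ)
  rw [this]
  exact (memLp_ridge _ θ).sub ((memLp_ridge _ θ).const_mul _)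

theorem ridge_mem_graph_ouOp (P : ℂ[X]) (θ : Euc d) :
    ((memLp_ridge P θ).toLp, (memLp_ouDiff_ridge P θ).toLp) ∈ (ouOp d).graph := by
  refine toLp_mem_graph_ouOp (contDiff_ridge P θ) _ ?_ (fun i => ?_) _
  · obtain ⟨C, hC0, hC⟩ := exists_norm_ridge_le_exp P θ
    refine ((memLp_exp_norm (1 + ‖θ‖)).const_mul C).mono'
      (by have := (contDiff_ridge P θ (n := 0)).continuous; fun_prop) (ae_of_all _ fun x => ?_)
    rw [Real.norm_of_nonneg (by positivity), add_mul 1 ‖θ‖, Real.exp_add, one_mul]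
    have h1 := Real.add_one_le_exp ‖x‖
    calc (1 + ‖x‖) * ‖ridge P θ x‖ ≤ Real.exp ‖x‖ * (C * Real.exp (‖θ‖ * ‖x‖)) := by
          gcongr
          · linarith
          · exact hC x
      _ = _ := by ring
  · rw [pd_ridge]
    exact (memLp_ridge _ θ).const_mul _

/-- For a unit vector this is Hermite's equation. The constant case `n = 0` allows any `θ`,
including the zero vector that arises as the direction of `ξ = 0` (and when `d = 0`). -/
theorem hermite_ridge_mem_eigenspace (n : ℕ) (θ : Euc d) (h : ‖θ‖ = 1 ∨ n = 0) :
    (memLp_ridge (hermiteC n) θ).toLp ∈ graphEigenspace (ouOp d) n := by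
  rw [mem_graphEigenspace]
  convert! ridge_mem_graph_ouOp (hermiteC n) θ using 2
  rw [← MemLp.toLp_const_smul]
  congr 1
  funext x
  rw [ouDiff_ridge]
  rcases h with h | rfl
  · have := congrArg (fun P : ℂ[X] => P.eval ((inner ℝ θ x : ℝ) : ℂ)) (hermiteC_differential_equation n)
    simp only [eval_sub, eval_mul, eval_natCast] at this
    rw [h]
    simp only [ridge, eval_mul, Pi.smul_apply, smul_eq_mul, ← this]
    simp
  · simp [hermiteC, ridge]

end HermiteRidge

/-! ### Eigenfunction expansion and totality of plane waves -/

section PlaneWaves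

variable {d : ℕ}

/-- The function `exp(iq ξ·x - (1 - q²)|ξ|²/2)`; for `q = 1` it is a plane wave, and for
`q = exp(-z)` it is the image of that plane wave under `exp(-zL)`. -/
def waveFun (q : ℂ) (ξ x : Euc d) : ℂ :=
  Complex.exp (Complex.I * q * (inner ℝ ξ x : ℝ) - (1 - q ^ 2) * ((‖ξ‖ ^ 2 : ℝ) : ℂ) / 2)

theorem continuous_waveFun (q : ℂ) (ξ : Euc d) : Continuous (waveFun q ξ) := by
  unfold waveFun
  fun_prop

theorem memLp_waveFun (q : ℂ) (ξ : Euc d) : MemLp (waveFun q ξ) 2 (gaussM d) := by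
  refine memLp_of_norm_le_exp (continuous_waveFun q ξ)
    (C := Real.exp (‖(1 - q ^ 2) * ((‖ξ‖ ^ 2 : ℝ) : ℂ) / 2‖)) (K := ‖q‖ * ‖ξ‖) fun x => ?_
  rw [← Real.exp_add]
  refine (Complex.norm_exp_le_exp_norm _).trans (Real.exp_le_exp.2 ?_)
  refine (norm_sub_le _ _).trans ?_
  rw [add_comm]
  gcongr
  rw [norm_mul, norm_mul, Complex.norm_I, one_mul, mul_assoc, Complex.norm_real]
  gcongr
  exact norm_inner_le_norm ξ x

/-- The class of `waveFun` in `L²(γ)`. -/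
def wave (q : ℂ) (ξ : Euc d) : L2γ d := (memLp_waveFun q ξ).toLp

theorem toLp_finset_sum {α : Type*} [MeasurableSpace α] {μ : Measure α} {f : ℕ → α → ℂ}
    (hf : ∀ n, MemLp (f n) 2 μ) (s : Finset ℕ) (h : MemLp (fun x => ∑ n ∈ s, f n x) 2 μ) :
    h.toLp = ∑ n ∈ s, (hf n).toLp := by
  induction s using Finset.induction_on with
  | empty =>
    rw [Finset.sum_empty, ← MemLp.toLp_zero (MemLp.zero' )]
    rfl
  | insert a s ha ih =>
    rw [Finset.sum_insert ha, ← ih (memLp_finsetSum s fun n _ => hf n), ← MemLp.toLp_add]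
    congr 1
    funext x
    simp [Finset.sum_insert ha]

/-- The generating function at parameter `qτ`, with `τ = i|ξ|` and `θ = ξ/|ξ|`, times
`exp(-|ξ|²/2)`. One sequence `v` serves all `q`, so an operator with eigenvalues `qⁿ` takes the
plane wave to `wave q ξ`. -/
theorem wave_expansion (ξ : Euc d) : ∃ v : ℕ → L2γ d,
    (∀ n : ℕ, v n ∈ graphEigenspace (ouOp d) n) ∧ ∀ q : ℂ, HasSum (fun n : ℕ => q ^ n • v n) (wave q ξ) := by
  let θ : Euc d := ‖ξ‖⁻¹ • ξ
  let τ : ℂ := Complex.I * (‖ξ‖ : ℂ)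
  let c : ℕ → ℂ := fun n => Complex.exp (-((‖ξ‖ ^ 2 : ℝ) : ℂ) / 2) * (τ ^ n / (n.factorial : ℂ))
  have hθτ : ∀ x, (‖ξ‖ : ℂ) * (inner ℝ θ x : ℝ) = (inner ℝ ξ x : ℝ) := by
    intro x
    rcases eq_or_ne ξ 0 with rfl | h
    · simp
    · have : ‖ξ‖ ≠ 0 := norm_ne_zero_iff.2 h
      rw [← Complex.ofReal_mul, real_inner_smul_left]
      field_simp
  refine ⟨fun n => c n • (memLp_ridge (hermiteC n) θ).toLp, fun n => ?_, fun q => ?_⟩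
  -- For `ξ = 0` the direction `θ` degenerates to `0`, but `τ = 0` leaves only the constant term.
  · rcases eq_or_ne ξ 0 with rfl | h
    · rcases eq_or_ne n 0 with rfl | hn
      · exact Submodule.smul_mem _ _ (hermite_ridge_mem_eigenspace 0 θ (Or.inr rfl))
      · have : c n = 0 := by simp [c, τ, hn]
        beta_reduce
        rw [this, zero_smul]
        exact Submodule.zero_mem _
    · refine Submodule.smul_mem _ _ (hermite_ridge_mem_eigenspace n θ (Or.inl ?_))
      rw [norm_smul, norm_inv, norm_norm, inv_mul_cancel₀ (norm_ne_zero_iff.2 h)]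
  -- This makes `‖qτ‖/R ≤ 1/2`, so every partial sum is dominated by `∑ 2⁻ⁿ = 2` times one
  -- exponential; the `+ 1` keeps `R` positive when `qτ = 0`.
  · let R : ℝ := 2 * ‖q * τ‖ + 1
    have hR : 0 < R := by positivity
    let f : ℕ → Euc d → ℂ := fun n x => q ^ n * (c n * ridge (hermiteC n) θ x)
    have hf : ∀ n, MemLp (f n) 2 (gaussM d) := fun n =>
      ((memLp_ridge (hermiteC n) θ).const_mul (c n)).const_mul (q ^ n)
    have hfs : ∀ s : Finset ℕ, MemLp (fun x => ∑ n ∈ s, f n x) 2 (gaussM d) := fun s =>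
      memLp_finsetSum s fun n _ => hf n
    have key : Tendsto (fun s => (hfs s).toLp) atTop (𝓝 (wave q ξ)) := by
      refine tendsto_toLp_of_dominated hfs (memLp_waveFun q ξ)
        (bound := fun x => (2 * Real.exp (R ^ 2 / 2)) * Real.exp (R * ‖θ‖ * ‖x‖))
        ((memLp_exp_norm _).const_mul _) (fun s x => ?_) (fun x => ?_)
      · have hterm : ∀ n, ‖f n x‖ ≤ (1 / 2) ^ n * (Real.exp (R ^ 2 / 2) * Real.exp (R * ‖θ‖ * ‖x‖)) := by
          intro n
          have h1 := norm_hermiteC_eval_le ((inner ℝ θ x : ℝ) : ℂ) n hR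
          have h2 : ‖((inner ℝ θ x : ℝ) : ℂ)‖ ≤ ‖θ‖ * ‖x‖ := by
            rw [Complex.norm_real]; exact norm_inner_le_norm θ x
          have h3 : ‖Complex.exp (-((‖ξ‖ ^ 2 : ℝ) : ℂ) / 2)‖ ≤ 1 := by
            rw [Complex.norm_exp, Real.exp_le_one_iff]
            have : (-((‖ξ‖ ^ 2 : ℝ) : ℂ) / 2).re = -(‖ξ‖ ^ 2) / 2 := by
              rw [← Complex.ofReal_neg]; simp [-Complex.ofReal_pow, -Complex.ofReal_neg]
            rw [this]
            have := sq_nonneg ‖ξ‖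
            linarith
          have h4 : ‖q * τ‖ / R ≤ 1 / 2 := by
            rw [div_le_div_iff₀ hR two_pos]
            simp only [R]
            linarith
          calc ‖f n x‖ = ‖Complex.exp (-((‖ξ‖ ^ 2 : ℝ) : ℂ) / 2)‖ * (‖q * τ‖ ^ n / n.factorial) *
                ‖(hermiteC n).eval ((inner ℝ θ x : ℝ) : ℂ)‖ := by
                simp only [f, c, ridge, norm_mul, norm_pow, norm_div, Complex.norm_natCast]
                ring
            _ ≤ 1 * (‖q * τ‖ ^ n / n.factorial) *
                (n.factorial * Real.exp (R * (‖θ‖ * ‖x‖) + R ^ 2 / 2) / R ^ n) := by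
                gcongr
                refine h1.trans ?_
                gcongr
            _ = (‖q * τ‖ / R) ^ n * (Real.exp (R ^ 2 / 2) * Real.exp (R * ‖θ‖ * ‖x‖)) := by
                rw [← Real.exp_add, div_pow]
                have : (n.factorial : ℝ) ≠ 0 := by positivity
                field_simp
                ring_nf
            _ ≤ _ := by gcongr
        refine (norm_sum_le_of_le s fun n _ => hterm n).trans ?_
        rw [← Finset.sum_mul, mul_assoc 2]
        refine mul_le_mul_of_nonneg_right ?_ (by positivity)
        exact (summable_geometric_two.sum_le_tsum s fun n _ => by positivity).trans
          tsum_geometric_two.le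
      · have h1 := (hasSum_hermite_generating ((inner ℝ θ x : ℝ) : ℂ) (q * τ)).mul_left
          (Complex.exp (-((‖ξ‖ ^ 2 : ℝ) : ℂ) / 2))
        have h2 : ∀ n : ℕ, f n x = Complex.exp (-((‖ξ‖ ^ 2 : ℝ) : ℂ) / 2) *
            ((q * τ) ^ n / (n.factorial : ℂ) * (hermiteC n).eval ((inner ℝ θ x : ℝ) : ℂ)) := fun n => by
          simp only [f, c, ridge]
          ring
        simp only [h2]
        have h3 : waveFun q ξ x = Complex.exp (-((‖ξ‖ ^ 2 : ℝ) : ℂ) / 2) *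
            Complex.exp (q * τ * ((inner ℝ θ x : ℝ) : ℂ) - (q * τ) ^ 2 / 2) := by
          rw [← Complex.exp_add, waveFun, ← hθτ x]
          congr 1
          simp only [τ]
          push_cast
          ring_nf
          simp
          ring
        rw [h3]
        exact h1
    rw [HasSum]
    refine key.congr fun s => ?_
    rw [toLp_finset_sum hf]
    refine Finset.sum_congr rfl fun n _ => ?_
    rw [smul_smul, ← MemLp.toLp_const_smul]
    congr 1
    funext x
    simp only [f, Pi.smul_apply, smul_eq_mul, mul_assoc]

theorem waveFun_one (ξ x : Euc d) :
    waveFun 1 ξ x = Complex.exp (Complex.I * (inner ℝ ξ x : ℝ)) := by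
  simp [waveFun]

/-- A function in `L²(γ)` that is orthogonal to all plane waves vanishes. -/
theorem eq_zero_of_inner_wave {f : L2γ d} (h : ∀ ξ, inner ℂ (wave 1 ξ) f = 0) : f = 0 := by
  have hf1 : Integrable (fun x => f x) (gaussM d) := by
    have h1 : MemLp (fun _ : Euc d => (1 : ℂ)) 2 (gaussM d) :=
      memLp_of_norm_le_exp continuous_const (C := 1) (K := 0) (by simp)
    exact ((Lp.memLp f).integrable_mul h1).congr (ae_of_all _ fun x => mul_one _)
  have hcpos := lebM_const_pos d
  have hg : Integrable (fun x => gaussWeight d x * f x) := by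
    have hf2 := (integrable_withDensity_iff_integrable_smul' (by fun_prop)
      (ae_of_all _ fun _ => ENNReal.ofReal_lt_top)).1 hf1
    refine (hf2.smul ((2 * Real.pi) ^ (-(d : ℝ) / 2))⁻¹).congr (ae_of_all _ fun x => ?_)
    simp only [Pi.smul_apply]
    rw [ENNReal.toReal_ofReal (by positivity), smul_smul, ← mul_assoc, inv_mul_cancel₀ hcpos.ne',
      one_mul, Complex.real_smul, gaussWeight]
  -- Orthogonality to the plane wave of frequency `2πw` is the vanishing of this Fourier transform
  -- at `w`.
  have hF : 𝓕 (fun x => gaussWeight d x * f x) = 0 := by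
    funext w
    have h1 := h ((2 * Real.pi) • w)
    have h2 : inner ℂ (wave 1 ((2 * Real.pi) • w)) f = ∫ x, (starRingEnd ℂ)
        (Complex.exp (Complex.I * (inner ℝ ((2 * Real.pi) • w) x : ℝ))) * f x ∂(gaussM d) := by
      rw [L2.inner_def]
      refine integral_congr_ae ?_
      filter_upwards [(memLp_waveFun 1 ((2 * Real.pi) • w)).coeFn_toLp] with x hx
      rw [wave, hx, waveFun_one, RCLike.inner_apply, mul_comm]
    rw [h2, integral_gaussM, mul_eq_zero, or_iff_right (by exact_mod_cast hcpos.ne')] at h1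
    rw [Real.fourier_eq', Pi.zero_apply, ← h1]
    refine integral_congr_ae (ae_of_all _ fun x => ?_)
    simp only [smul_eq_mul]
    rw [← Complex.exp_conj, map_mul, Complex.conj_I, Complex.conj_ofReal, real_inner_smul_left,
      real_inner_comm x w]
    push_cast
    ring_nf
  have h0 : ∀ᵐ x ∂(volume : Measure (Euc d)), gaussWeight d x * f x = 0 := by
    -- The weighted function is known only to be integrable, so injectivity is proved by duality:
    -- write a test function as `𝓕 Φ` with `Φ` Schwartz and move the transform across the integral.
    refine ae_eq_zero_of_integral_contDiff_smul_eq_zero hg.locallyIntegrable fun ψ hψ hψc => ?_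
    let Ψ : 𝓢(Euc d, ℂ) := HasCompactSupport.toSchwartzMap
      (f := fun x => (ψ x : ℂ)) (hψc.comp_left (g := ((↑) : ℝ → ℂ)) Complex.ofReal_zero)
      (Complex.ofRealCLM.contDiff.comp hψ)
    let Φ : 𝓢(Euc d, ℂ) := 𝓕⁻ Ψ
    have h3 : (fun x => (ψ x : ℂ)) = 𝓕 (⇑Φ) := by
      rw [← SchwartzMap.fourier_coe, FourierTransform.fourier_fourierInv_eq]
      rfl
    have h4 := VectorFourier.integral_fourierIntegral_smul_eq_flip (L := innerₗ (Euc d))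
      (μ := volume) (ν := volume) Real.continuous_fourierChar continuous_inner
      Φ.integrable hg
    rw [flip_innerₗ] at h4
    change ∫ ξ, 𝓕 (⇑Φ) ξ • (gaussWeight d ξ * f ξ) =
      ∫ x, Φ x • 𝓕 (fun x => gaussWeight d x * f x) x at h4
    rw [← h3, hF] at h4
    simpa using! h4
  rw [Lp.eq_zero_iff_ae_eq_zero]
  have hac : gaussM d ≪ (volume : Measure (Euc d)) := withDensity_absolutelyContinuous _ _
  filter_upwards [hac.ae_le h0] with x hx
  exact (mul_eq_zero.1 hx).resolve_left (by
    rw [gaussWeight]; exact_mod_cast (Real.exp_pos _).ne')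

end PlaneWaves

/-! ### Gaussian integrals and inner products of waves -/

section GaussianIntegrals

variable {d : ℕ}

/-- Two real vectors with complex coefficients encode the complex linear form `(c₁p + c₂q)·v`, and
its bilinear square, without leaving the real inner product. -/
theorem integral_gaussian_linear {b : ℂ} (hb : 0 < b.re) (c₁ c₂ : ℂ) (p q : Euc d) :
    ∫ v : Euc d, Complex.exp (-b * ((‖v‖ ^ 2 : ℝ) : ℂ) + c₁ * (inner ℝ p v : ℝ) +
        c₂ * (inner ℝ q v : ℝ)) =
      (Real.pi / b) ^ ((d : ℂ) / 2) * Complex.exp ((c₁ ^ 2 * ((‖p‖ ^ 2 : ℝ) : ℂ) +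
        2 * c₁ * c₂ * (inner ℝ p q : ℝ) + c₂ ^ 2 * ((‖q‖ ^ 2 : ℝ) : ℂ)) / (4 * b)) := by
  have h := GaussianFourier.integral_cexp_neg_mul_sum_add hb
    (fun i : Fin d => c₁ * (p i : ℂ) + c₂ * (q i : ℂ))
  rw [← (PiLp.volume_preserving_toLp (Fin d)).integral_comp
    (MeasurableEquiv.toLp 2 _).measurableEmbedding]
  rw [Fintype.card_fin] at h
  convert! h using 3
  · congr 1
    simp only [EuclideanSpace.real_norm_sq_eq, PiLp.inner_apply, RCLike.inner_apply, conj_trivial,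
      Complex.ofReal_sum, Complex.ofReal_mul, Complex.ofReal_pow, Finset.mul_sum]
    rw [← Finset.sum_add_distrib, ← Finset.sum_add_distrib, ← Finset.sum_add_distrib]
    refine Finset.sum_congr rfl fun i _ => ?_
    ring
  · congr 1
    simp only [EuclideanSpace.real_norm_sq_eq, PiLp.inner_apply, RCLike.inner_apply, conj_trivial,
      Complex.ofReal_sum, Complex.ofReal_mul, Complex.ofReal_pow, Finset.mul_sum]
    rw [← Finset.sum_add_distrib, ← Finset.sum_add_distrib]
    refine Finset.sum_congr rfl fun i _ => ?_
    ring

theorem integral_lebM (F : Euc d → ℂ) :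
    ∫ x, F x ∂(lebM d) = ((2 * Real.pi) ^ (-(d : ℝ) / 2) : ℝ) * ∫ x, F x := by
  rw [lebM, integral_smul_measure, ENNReal.toReal_ofReal (lebM_const_pos d).le, Complex.real_smul]

theorem lebM_const_mul_cpow : (((2 * Real.pi) ^ (-(d : ℝ) / 2) : ℝ) : ℂ) *
    ((Real.pi : ℂ) / (1 / 2 : ℂ)) ^ ((d : ℂ) / 2) = 1 := by
  have h1 : ((Real.pi : ℂ) / (1 / 2 : ℂ)) = ((2 * Real.pi : ℝ) : ℂ) := by push_cast; ring
  have h2 : ((d : ℂ) / 2) = (((d : ℝ) / 2 : ℝ) : ℂ) := by push_cast; ring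
  rw [h1, h2, ← Complex.ofReal_cpow (by positivity), ← Complex.ofReal_mul,
    ← Real.rpow_add (by positivity)]
  simp [neg_div]

theorem inner_wave (q : ℂ) (ξ η : Euc d) : inner ℂ (wave 1 η) (wave q ξ) =
    Complex.exp (-((‖ξ‖ ^ 2 : ℝ) : ℂ) / 2 - ((‖η‖ ^ 2 : ℝ) : ℂ) / 2 + q * (inner ℝ ξ η : ℝ)) := by
  have h : inner ℂ (wave 1 η) (wave q ξ) =
      ∫ x, (starRingEnd ℂ) (waveFun 1 η x) * waveFun q ξ x ∂(gaussM d) := by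
    rw [L2.inner_def]
    refine integral_congr_ae ?_
    filter_upwards [(memLp_waveFun 1 η).coeFn_toLp, (memLp_waveFun q ξ).coeFn_toLp] with x h1 h2
    rw [wave, wave, h1, h2, RCLike.inner_apply, mul_comm]
  have h1 : ∀ x, gaussWeight d x * ((starRingEnd ℂ) (waveFun 1 η x) * waveFun q ξ x) =
      Complex.exp (-(1 - q ^ 2) * ((‖ξ‖ ^ 2 : ℝ) : ℂ) / 2) *
        Complex.exp (-(1 / 2 : ℂ) * ((‖x‖ ^ 2 : ℝ) : ℂ) + (Complex.I * q) * (inner ℝ ξ x : ℝ) +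
          (-Complex.I) * (inner ℝ η x : ℝ)) := by
    intro x
    rw [waveFun_one, ← Complex.exp_conj, waveFun, gaussWeight, Complex.ofReal_exp,
      ← Complex.exp_add, ← Complex.exp_add, ← Complex.exp_add, map_mul, Complex.conj_I,
      Complex.conj_ofReal]
    congr 1
    push_cast
    ring
  rw [h, integral_gaussM]
  simp_rw [h1]
  rw [integral_const_mul, integral_gaussian_linear (by norm_num), mul_left_comm, ← mul_assoc,
    ← mul_assoc, mul_assoc (Complex.exp _), lebM_const_mul_cpow, mul_one, ← Complex.exp_add]
  congr 1
  have hI := Complex.I_sq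
  linear_combination (((‖ξ‖ ^ 2 : ℝ) : ℂ) * q ^ 2 / 2 + ((‖η‖ ^ 2 : ℝ) : ℂ) / 2 -
    q * (inner ℝ ξ η : ℝ)) * hI

end GaussianIntegrals

/-! ### Spectral decomposition of `L` -/

section HilbertSum

variable (d : ℕ)

theorem eq_of_inner_wave {f g : L2γ d} (h : ∀ ξ, inner ℂ (wave 1 ξ) f = inner ℂ (wave 1 ξ) g) :
    f = g :=
  sub_eq_zero.1 (eq_zero_of_inner_wave fun ξ => by rw [inner_sub_right, h, sub_self])

theorem clm_ext_wave {S T : L2γ d →L[ℂ] L2γ d} (h : ∀ ξ, S (wave 1 ξ) = T (wave 1 ξ)) : S = T := by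
  have hd : Dense (Submodule.span ℂ (Set.range (wave (d := d) 1)) : Set (L2γ d)) := by
    rw [Submodule.dense_iff_topologicalClosure_eq_top, Submodule.topologicalClosure_eq_top_iff,
      Submodule.eq_bot_iff]
    intro f hf
    exact eq_zero_of_inner_wave fun ξ =>
      (Submodule.mem_orthogonal _ _).1 hf _ (Submodule.subset_span ⟨ξ, rfl⟩)
  refine ContinuousLinearMap.ext_on hd ?_
  rintro _ ⟨ξ, rfl⟩
  exact h ξ

/-- Eigenspaces are orthogonal by symmetry. A vector orthogonal to all of them is orthogonal to
every plane wave, by the expansion at `q = 1`, and hence zero. -/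
theorem isHilbertSum_ouOp : IsHilbertSum ℂ (fun n : ℕ => graphEigenspace (ouOp d) n)
    fun n => (graphEigenspace (ouOp d) n).subtypeₗᵢ := by
  have : ∀ n : ℕ, CompleteSpace (graphEigenspace (ouOp d) n) := fun n =>
    (isClosed_graphEigenspace isClosed_ouOp n).completeSpace_coe
  refine IsHilbertSum.mkInternal (fun n : ℕ => graphEigenspace (ouOp d) n)
    (orthogonalFamily_graphEigenspace isSymmetricGraph_ouOp) ?_
  rw [top_le_iff, Submodule.topologicalClosure_eq_top_iff, Submodule.eq_bot_iff]
  intro f hf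
  refine eq_zero_of_inner_wave fun ξ => ?_
  obtain ⟨v, hv, hs⟩ := wave_expansion ξ
  have hs1 := hs 1
  simp only [one_pow, one_smul] at hs1
  have h1 := hs1.mapL (innerSL ℂ f)
  have h0 : ∀ n, innerSL ℂ f (v n) = 0 := fun n => by
    rw [innerSL_apply_apply]
    exact (Submodule.mem_orthogonal' _ _).1 hf _ (Submodule.mem_iSup_of_mem n (hv n))
  simp only [h0] at h1
  rw [inner_eq_zero_symm]
  exact h1.unique hasSum_zero

/-- Applying the semigroup term by term to the expansion at `q = 1` produces the expansion at `q =
exp(-zt)`. -/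
theorem diagSemigroup_wave {z : ℂ} (hz : 0 ≤ z.re) (t : ℝ≥0) (ξ : Euc d) :
    diagSemigroup (isHilbertSum_ouOp d) z hz t (wave 1 ξ) =
      wave (Complex.exp (-(z * (t : ℝ)))) ξ := by
  obtain ⟨v, hv, hs⟩ := wave_expansion ξ
  have h1 := (hs 1).mapL (diagSemigroup (isHilbertSum_ouOp d) z hz t)
  refine h1.unique ?_
  convert hs (Complex.exp (-(z * (t : ℝ)))) using 2 with n
  rw [one_pow, one_smul, diagSemigroup_of_mem _ _ _ (hv n), ← Complex.exp_nat_mul]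
  congr 2
  ring

end HilbertSum

/-! ### Matrix elements of the Weyl operators -/

section WeylCalculus

variable {d : ℕ}

/-- The image under `U` of the plane wave `exp(iξ·x)`. -/
def uWaveFun (ξ x : Euc d) : ℂ :=
  ((2 : ℝ) ^ ((d : ℝ) / 4) : ℝ) *
    Complex.exp (-((‖x‖ ^ 2 : ℝ) : ℂ) / 2 + Complex.I * (√2 : ℝ) * (inner ℝ ξ x : ℝ))

theorem unitaryU_wave (ξ : Euc d) : unitaryU d (wave 1 ξ) =ᵐ[lebM d] uWaveFun ξ := by
  have h1 : unitaryE d (wave 1 ξ) =ᵐ[lebM d]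
      fun x => (Real.exp (-‖x‖ ^ 2 / 4) : ℂ) * waveFun 1 ξ x := by
    filter_upwards [(isUnitaryWeight_E d).coeFn_toUnitary (wave 1 ξ),
      (isUnitaryWeight_E d).qmp.ae (memLp_waveFun 1 ξ).coeFn_toLp] with x hx hy
    rw [unitaryE, hx, wave, hy]
    rfl
  filter_upwards [(isUnitaryWeight_dil d).coeFn_toUnitary (unitaryE d (wave 1 ξ)),
    (isUnitaryWeight_dil d).qmp.ae h1] with x hx hy
  change (isUnitaryWeight_dil d).toUnitary (unitaryE d (wave 1 ξ)) x = _
  rw [hx, hy]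
  change _ * (((Real.exp (-‖√2 • x‖ ^ 2 / 4) : ℝ) : ℂ) * waveFun 1 ξ (√2 • x)) = _
  have h2 : √2 ^ 2 = (2 : ℝ) := Real.sq_sqrt zero_le_two
  rw [uWaveFun, waveFun_one, Complex.ofReal_exp, ← Complex.exp_add, norm_smul, mul_pow,
    Real.norm_of_nonneg (Real.sqrt_nonneg 2), h2, real_inner_smul_right]
  congr 2
  push_cast
  ring

theorem expXD_uWave (u v ξ : Euc d) : expXD u v (unitaryU d (wave 1 ξ)) =ᵐ[lebM d] fun y =>
    Complex.exp (Complex.I * (inner ℝ u y : ℝ) + Complex.I / 2 * (inner ℝ u v : ℝ)) *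
      uWaveFun ξ (y + v) := by
  filter_upwards [(isUnitaryWeight_weyl d u v).coeFn_toUnitary (unitaryU d (wave 1 ξ)),
    (isUnitaryWeight_weyl d u v).qmp.ae (unitaryU_wave ξ)] with y hy hz
  rw [expXD, hy, hz]
  rfl

/-- The two dilation factors `2^{d/4}` normalise the `m`-integral of `exp(-|y|²)` to one. -/
theorem two_rpow_mul_lebM_const_mul_cpow :
    (((2 : ℝ) ^ ((d : ℝ) / 4) : ℝ) : ℂ) ^ 2 * ((((2 * Real.pi) ^ (-(d : ℝ) / 2) : ℝ) : ℂ) *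
    ((Real.pi : ℂ) / 1) ^ ((d : ℂ) / 2)) = 1 := by
  have h2 : ((d : ℂ) / 2) = (((d : ℝ) / 2 : ℝ) : ℂ) := by push_cast; ring
  rw [div_one, h2, ← Complex.ofReal_cpow (by positivity), ← Complex.ofReal_mul,
    ← Complex.ofReal_pow, ← Complex.ofReal_mul, Real.mul_rpow (by positivity) (by positivity),
    ← Real.rpow_mul_natCast (by positivity)]
  have h3 : (d : ℝ) / 4 * (2 : ℕ) = (d : ℝ) / 2 := by push_cast; ring
  rw [h3, neg_div, Real.rpow_neg (by positivity), Real.rpow_neg (by positivity)]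
  field_simp
  simp

/-- Matrix elements of the Weyl operators between the images of plane waves. -/
theorem inner_expXD_uWave (u v ξ η : Euc d) :
    inner ℂ (unitaryU d (wave 1 η)) (expXD u v (unitaryU d (wave 1 ξ))) =
      Complex.exp (-((‖u‖ ^ 2 : ℝ) : ℂ) / 4 - (√2 / 2 : ℝ) * (inner ℝ (ξ - η) u : ℝ) -
        ((‖ξ - η‖ ^ 2 : ℝ) : ℂ) / 2) *
      Complex.exp (-((‖v‖ ^ 2 : ℝ) : ℂ) / 4 +
        Complex.I * (√2 / 2 : ℝ) * (inner ℝ (ξ + η) v : ℝ)) := by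
  have h : inner ℂ (unitaryU d (wave 1 η)) (expXD u v (unitaryU d (wave 1 ξ))) =
      ∫ y, (starRingEnd ℂ) (uWaveFun η y) *
        (Complex.exp (Complex.I * (inner ℝ u y : ℝ) + Complex.I / 2 * (inner ℝ u v : ℝ)) *
          uWaveFun ξ (y + v)) ∂(lebM d) := by
    rw [L2.inner_def]
    refine integral_congr_ae ?_
    filter_upwards [unitaryU_wave η, expXD_uWave u v ξ] with y h1 h2
    rw [h1, h2, RCLike.inner_apply, mul_comm]
  have h1 : ∀ y, (starRingEnd ℂ) (uWaveFun η y) *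
        (Complex.exp (Complex.I * (inner ℝ u y : ℝ) + Complex.I / 2 * (inner ℝ u v : ℝ)) *
          uWaveFun ξ (y + v)) =
      ((((2 : ℝ) ^ ((d : ℝ) / 4) : ℝ) : ℂ) ^ 2 *
        Complex.exp (Complex.I / 2 * (inner ℝ u v : ℝ) - ((‖v‖ ^ 2 : ℝ) : ℂ) / 2 +
          Complex.I * (√2 : ℝ) * (inner ℝ ξ v : ℝ))) *
      Complex.exp (-1 * ((‖y‖ ^ 2 : ℝ) : ℂ) + (-1) * (inner ℝ v y : ℝ) +
        Complex.I * (inner ℝ (u + √2 • (ξ - η)) y : ℝ)) := by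
    intro y
    simp only [uWaveFun]
    rw [map_mul, Complex.conj_ofReal, ← Complex.exp_conj]
    have e : ∀ a b c e f g : ℂ, c * c = e → Complex.exp a * (Complex.exp b * Complex.exp f) = Complex.exp g →
      (c * Complex.exp a) * (Complex.exp b * (c * Complex.exp f)) = e * Complex.exp g := by
      intro a b c e f g h1 h2
      rw [← h1, ← h2]
      ring
    rw [mul_assoc (_ ^ 2)]
    rw [← Complex.exp_add _ (-1 * _ + _ + _)]
    refine e _ _ _ _ _ _ (sq _).symm ?_
    rw [← Complex.exp_add, ← Complex.exp_add]
    congr 1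
    rw [norm_add_sq_real, inner_add_right, inner_add_left, real_inner_smul_left, inner_sub_left,
      real_inner_comm v y]
    simp only [map_add, map_mul, map_neg, map_div₀, Complex.conj_I, Complex.conj_ofReal, map_ofNat]
    push_cast
    ring
  rw [h, integral_lebM]
  simp_rw [h1]
  -- The cross term of this integral contributes `-(i/2) u·v`, cancelling the symmetric phase `(i/2)
  -- u·v` of the Weyl operator; hence the matrix element splits into a function of `u` times a
  -- function of `v`.
  rw [integral_const_mul, integral_gaussian_linear (by norm_num)]
  have h2 := two_rpow_mul_lebM_const_mul_cpow (d := d)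
  have hs : ((√2 : ℝ) : ℂ) ^ 2 = 2 := by
    rw [← Complex.ofReal_pow, Real.sq_sqrt zero_le_two]; simp
  have hI := Complex.I_sq
  have e : ∀ a b c x y z : ℂ, a ^ 2 * (b * c) = 1 → Complex.exp (x + y) = z →
      b * (a ^ 2 * Complex.exp x * (c * Complex.exp y)) = z := by
    intro a b c x y z h1 h2
    rw [← h2, Complex.exp_add]
    linear_combination (Complex.exp x * Complex.exp y) * h1
  refine e _ _ _ _ _ _ h2 ?_
  rw [← Complex.exp_add]
  congr 1
  rw [norm_add_sq_real, norm_smul, mul_pow, Real.norm_of_nonneg (Real.sqrt_nonneg 2),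
    inner_add_right, real_inner_smul_right, real_inner_smul_right, inner_sub_right,
    inner_sub_right, inner_sub_left, inner_add_left, real_inner_comm ξ v, real_inner_comm η v,
    real_inner_comm u v, real_inner_comm ξ u, real_inner_comm η u]
  push_cast
  linear_combination ((√2 : ℂ) * (inner ℝ ξ u : ℝ) / 2 - (√2 : ℂ) * (inner ℝ η u : ℝ) / 2 +
    (‖u‖ : ℂ) ^ 2 / 4 + (√2 : ℂ) ^ 2 * (‖ξ - η‖ : ℂ) ^ 2 / 4) * hI - (‖ξ - η‖ : ℂ) ^ 2 / 4 * hs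

end WeylCalculus

/-! ### Weyl quantisation of Gaussians -/

section WeylGaussian

variable {d : ℕ}

theorem phaseFourier_gaussianSymbol {s : ℂ} (hs : 0 < s.re) (u v : Euc d) :
    phaseFourier (gaussianSymbol d s hs) u v =
      (((2 * Real.pi) ^ (-(d : ℝ) / 2) : ℝ) * ((Real.pi / s) ^ ((d : ℂ) / 2) *
        Complex.exp (-((‖u‖ ^ 2 : ℝ) : ℂ) / (4 * s)))) *
      (((2 * Real.pi) ^ (-(d : ℝ) / 2) : ℝ) * ((Real.pi / s) ^ ((d : ℂ) / 2) *
        Complex.exp (-((‖v‖ ^ 2 : ℝ) : ℂ) / (4 * s)))) := by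
  -- The dummy terms with coefficient `0` match the shape of `integral_gaussian_linear`, which has
  -- two linear forms.
  have h1 : ∀ p : Euc d × Euc d, Complex.exp (-Complex.I * ((inner ℝ p.1 u + inner ℝ p.2 v : ℝ) : ℂ)) *
      gaussianSymbol d s hs p =
      Complex.exp (-s * ((‖p.1‖ ^ 2 : ℝ) : ℂ) + (-Complex.I) * (inner ℝ u p.1 : ℝ) +
        0 * (inner ℝ u p.1 : ℝ)) *
      Complex.exp (-s * ((‖p.2‖ ^ 2 : ℝ) : ℂ) + (-Complex.I) * (inner ℝ v p.2 : ℝ) +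
        0 * (inner ℝ v p.2 : ℝ)) := by
    intro p
    change _ * Complex.exp (-s * ((‖p.1‖ ^ 2 + ‖p.2‖ ^ 2 : ℝ) : ℂ)) = _
    rw [← Complex.exp_add, ← Complex.exp_add, real_inner_comm u, real_inner_comm v]
    congr 1
    push_cast
    ring
  rw [phaseFourier]
  simp_rw [h1]
  rw [integral_prod_mul (fun x : Euc d => Complex.exp (-s * ((‖x‖ ^ 2 : ℝ) : ℂ) +
      (-Complex.I) * (inner ℝ u x : ℝ) + 0 * (inner ℝ u x : ℝ)))
    (fun x : Euc d => Complex.exp (-s * ((‖x‖ ^ 2 : ℝ) : ℂ) +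
      (-Complex.I) * (inner ℝ v x : ℝ) + 0 * (inner ℝ v x : ℝ))),
    integral_lebM, integral_lebM, integral_gaussian_linear hs, integral_gaussian_linear hs]
  simp

theorem ne_zero_of_re_pos {s : ℂ} (hs : 0 < s.re) : s ≠ 0 := by
  rintro rfl
  simp at hs

theorem one_add_ne_zero_of_re_pos {s : ℂ} (hs : 0 < s.re) : 1 + s ≠ 0 :=
  ne_zero_of_re_pos (by simp; linarith)

/-- This is `1/(4s) + 1/4`: the decay rate of the transformed symbol plus that of the Weyl matrix
elements. -/
theorem re_one_add_div_pos {s : ℂ} (hs : 0 < s.re) : 0 < ((1 + s) / (4 * s)).re := by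
  have h : (1 + s) / (4 * s) = (1 / 4 : ℝ) * (s⁻¹ + 1) := by
    have := ne_zero_of_re_pos hs
    push_cast
    field_simp
  rw [h, Complex.re_ofReal_mul, Complex.add_re, Complex.inv_re, Complex.one_re]
  have : 0 < Complex.normSq s := Complex.normSq_pos.2 (ne_zero_of_re_pos hs)
  positivity

/-- The `u`- and `v`-integrals contribute equal constants, so each power `d/2` occurs squared. Only
integer powers remain, and no branch of the complex power has to be tracked. -/
theorem gaussian_constants {s : ℂ} (hs : 0 < s.re) :
    ((((2 * Real.pi) ^ (-(d : ℝ) / 2) : ℝ) : ℂ) ^ 2 * ((Real.pi / s) ^ ((d : ℂ) / 2) *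
      (Real.pi / ((1 + s) / (4 * s))) ^ ((d : ℂ) / 2))) ^ 2 * (1 + s) ^ d = 1 := by
  have hs0 := ne_zero_of_re_pos hs
  have hs1 := one_add_ne_zero_of_re_pos hs
  have hpi : (Real.pi : ℂ) ≠ 0 := by exact_mod_cast Real.pi_ne_zero
  have h1 : ∀ a : ℂ, (a ^ ((d : ℂ) / 2)) ^ 2 = a ^ d := fun a => by
    rw [← Complex.cpow_nat_mul]
    have : ((2 : ℕ) : ℂ) * ((d : ℂ) / 2) = d := by push_cast; ring
    rw [this, Complex.cpow_natCast]
  have h2 : (((2 * Real.pi) ^ (-(d : ℝ) / 2) : ℝ) : ℂ) ^ 2 = (((2 * Real.pi : ℝ) : ℂ)⁻¹) ^ d := by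
    rw [← Complex.ofReal_pow, ← Real.rpow_mul_natCast (by positivity)]
    have : -(d : ℝ) / 2 * (2 : ℕ) = -(d : ℝ) := by push_cast; ring
    rw [this, Real.rpow_neg (by positivity), Real.rpow_natCast]
    push_cast
    rw [inv_pow]
  rw [mul_pow, mul_pow, h1, h1, h2, ← pow_mul, mul_comm d 2, pow_mul, ← mul_pow, ← mul_pow, ← mul_pow]
  convert one_pow d using 2
  push_cast
  field_simp
  ring

/-- Matrix elements of the Weyl quantisation of a Gaussian between plane waves. -/
theorem inner_weylQP_gaussianSymbol {s : ℂ} (hs : 0 < s.re) (ξ η : Euc d) :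
    (1 + s) ^ d * inner ℂ (wave 1 η) (weylQP (gaussianSymbol d s hs) (wave 1 ξ)) =
      inner ℂ (wave 1 η) (wave ((1 - s) / (1 + s)) ξ) := by
  have hs0 := ne_zero_of_re_pos hs
  have hs1 := one_add_ne_zero_of_re_pos hs
  have hβ := re_one_add_div_pos hs
  have h1 : inner ℂ (wave 1 η) (weylQP (gaussianSymbol d s hs) (wave 1 ξ)) =
      ∫ p : Euc d × Euc d, phaseFourier (gaussianSymbol d s hs) p.1 p.2 *
        inner ℂ (unitaryU d (wave 1 η)) (expXD p.1 p.2 (unitaryU d (wave 1 ξ)))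
        ∂((lebM d).prod (lebM d)) := by
    have h : inner ℂ (wave 1 η) (weylQP (gaussianSymbol d s hs) (wave 1 ξ)) =
        inner ℂ (unitaryU d (wave 1 η)) (weylXD (gaussianSymbol d s hs) (unitaryU d (wave 1 ξ))) := by
      rw [← (unitaryU d).inner_map_map]
      congr 1
      exact (unitaryU d).apply_symm_apply _
    rw [h]
    refine ((innerSL ℂ (unitaryU d (wave 1 η))).integral_comp_comm
      (integrable_weyl (gaussianSymbol d s hs) (unitaryU d (wave 1 ξ)))).symm.trans ?_
    simp only [innerSL_apply_apply, inner_smul_right]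
  let κ : ℂ := (((2 * Real.pi) ^ (-(d : ℝ) / 2) : ℝ) : ℂ)
  let G : ℂ := (Real.pi / s) ^ ((d : ℂ) / 2)
  let β : ℂ := (1 + s) / (4 * s)
  have h2 : ∀ p : Euc d × Euc d, phaseFourier (gaussianSymbol d s hs) p.1 p.2 *
      inner ℂ (unitaryU d (wave 1 η)) (expXD p.1 p.2 (unitaryU d (wave 1 ξ))) =
      (κ * G * Complex.exp (-((‖ξ - η‖ ^ 2 : ℝ) : ℂ) / 2) *
        Complex.exp (-β * ((‖p.1‖ ^ 2 : ℝ) : ℂ) + (-(√2 / 2 : ℝ)) * (inner ℝ (ξ - η) p.1 : ℝ) +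
          0 * (inner ℝ (ξ - η) p.1 : ℝ))) *
      (κ * G * Complex.exp (-β * ((‖p.2‖ ^ 2 : ℝ) : ℂ) +
        (Complex.I * (√2 / 2 : ℝ)) * (inner ℝ (ξ + η) p.2 : ℝ) + 0 * (inner ℝ (ξ + η) p.2 : ℝ))) := by
    intro p
    have hβ' : ∀ x : ℂ, -β * x = -x / (4 * s) + -x / 4 := fun x => by
      simp only [β]
      field_simp
      ring
    rw [inner_expXD_uWave, phaseFourier_gaussianSymbol, hβ', hβ', sub_eq_add_neg]
    simp only [Complex.exp_add, zero_mul, Complex.exp_zero, mul_one, κ, G, neg_mul, neg_div,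
      sub_eq_add_neg]
    ring
  rw [h1]
  simp_rw [h2]
  rw [integral_prod_mul (fun x : Euc d => κ * G * Complex.exp (-((‖ξ - η‖ ^ 2 : ℝ) : ℂ) / 2) *
        Complex.exp (-β * ((‖x‖ ^ 2 : ℝ) : ℂ) + (-(√2 / 2 : ℝ)) * (inner ℝ (ξ - η) x : ℝ) +
          0 * (inner ℝ (ξ - η) x : ℝ)))
      (fun x : Euc d => κ * G * Complex.exp (-β * ((‖x‖ ^ 2 : ℝ) : ℂ) +
        (Complex.I * (√2 / 2 : ℝ)) * (inner ℝ (ξ + η) x : ℝ) + 0 * (inner ℝ (ξ + η) x : ℝ))),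
    integral_lebM, integral_lebM, integral_const_mul, integral_const_mul,
    integral_gaussian_linear hβ, integral_gaussian_linear hβ, inner_wave]
  have hc := gaussian_constants (d := d) hs
  have key : ∀ κ G B e₁ e₂ e₃ e₄ c : ℂ, (κ ^ 2 * (G * B)) ^ 2 * c = 1 →
      Complex.exp (e₁ + e₂ + e₃) = e₄ →
      c * (κ * (κ * G * Complex.exp e₁ * (B * Complex.exp e₂)) *
        (κ * (κ * G * (B * Complex.exp e₃)))) = e₄ := by
    intro κ G B e₁ e₂ e₃ e₄ c h1 h2
    rw [← h2, Complex.exp_add, Complex.exp_add]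
    linear_combination (Complex.exp e₁ * Complex.exp e₂ * Complex.exp e₃) * h1
  refine key _ _ _ _ _ _ _ _ hc ?_
  congr 1
  have h2s : ((√2 : ℝ) : ℂ) ^ 2 = 2 := by
    rw [← Complex.ofReal_pow, Real.sq_sqrt zero_le_two]; simp
  have hI := Complex.I_sq
  -- With `4β = (1 + s)/s` the two integrals contribute `s(|ξ - η|² - |ξ + η|²)/(2(1 + s)) = -2s
  -- ξ·η/(1 + s)`. Added to `-|ξ - η|²/2`, this turns the coefficient of `ξ·η` into `1 - 2s/(1 + s)
  -- = (1 - s)/(1 + s)`.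
  rw [norm_sub_sq_real, norm_add_sq_real]
  simp only [zero_mul, mul_zero, add_zero, ne_eq, OfNat.ofNat_ne_zero, not_false_eq_true, zero_pow]
  push_cast
  have e1 : (-((√2 : ℂ) / 2)) ^ 2 = 1 / 2 := by rw [neg_sq, div_pow, h2s]; norm_num
  have e2 : (Complex.I * ((√2 : ℂ) / 2)) ^ 2 = -(1 / 2) := by
    rw [mul_pow, div_pow, h2s, hI]; norm_num
  rw [e1, e2]
  field_simp
  ring

/-- Both operators are bounded, so equality of matrix elements between plane waves suffices. The
parameters interact only through `h`, which lets the same statement serve real and complex time. -/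
theorem diagSemigroup_eq_weylQP {s z : ℂ} (hs : 0 < s.re) (hz : 0 ≤ z.re) (t : ℝ≥0)
    (h : (1 - s) / (1 + s) = Complex.exp (-(z * (t : ℝ)))) :
    diagSemigroup (isHilbertSum_ouOp d) z hz t = (1 + s) ^ d • weylQP (gaussianSymbol d s hs) := by
  refine clm_ext_wave d fun ξ => eq_of_inner_wave d fun η => ?_
  rw [diagSemigroup_wave, ← h, ← inner_weylQP_gaussianSymbol hs, smul_apply, inner_smul_right]

theorem one_add_ne_zero_of_norm_lt_one {q : ℂ} (hq : ‖q‖ < 1) : 1 + q ≠ 0 := fun h => by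
  rw [← neg_eq_of_add_eq_zero_right h, norm_neg, norm_one] at hq
  exact lt_irrefl _ hq

/-- The real part equals `(1 - |q|²)/|1 + q|²`: the Cayley transform takes the unit disc into the
right half-plane. -/
theorem re_mobius_pos {q : ℂ} (hq : ‖q‖ < 1) : 0 < ((1 - q) / (1 + q)).re := by
  have hne := one_add_ne_zero_of_norm_lt_one hq
  have hsq : q.re * q.re + q.im * q.im < 1 := by
    rw [← Complex.normSq_apply, Complex.normSq_eq_norm_sq]
    nlinarith [norm_nonneg q]
  rw [Complex.div_re, ← add_div]
  refine div_pos ?_ (Complex.normSq_pos.2 hne)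
  simp
  nlinarith

theorem mobius_involutive {q : ℂ} (hq : ‖q‖ < 1) :
    (1 - (1 - q) / (1 + q)) / (1 + (1 - q) / (1 + q)) = q := by
  have hne := one_add_ne_zero_of_norm_lt_one hq
  field_simp
  ring

theorem norm_cexp_neg_lt_one {z : ℂ} (hz : 0 < z.re) : ‖Complex.exp (-z)‖ < 1 := by
  rw [Complex.norm_exp, Real.exp_lt_one_iff]
  simpa using hz

end WeylGaussian

end GaussianWeyl

end

/-! ### The theorem -/

open GaussianWeyl
theorem theorem3p1 (d : ℕ) :
    -- `-L` generates a unique `C₀`-semigroup, so that `exp(-tL)` is well defined for real time,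
    (∃! T : ℝ≥0 → L2γ d →L[ℂ] L2γ d, IsC0SemigroupGeneratedBy (-(ouOp d)) T) ∧
    -- and it is given by the Weyl calculus;
    (∀ t : ℝ≥0, 0 < t →
      let s : ℝ := (1 - Real.exp (-t)) / (1 + Real.exp (-t))
      ∃ hs : 0 < (s : ℂ).re,
        semigroupOf (-(ouOp d)) t = (1 + (s : ℂ)) ^ d • weylQP (gaussianSymbol d s hs)) ∧
    -- `exp(-zL)` is well defined for `Re z > 0`,
    (∀ z : ℂ, 0 < z.re →
      ∃! T : ℝ≥0 → L2γ d →L[ℂ] L2γ d, IsC0SemigroupGeneratedBy (-(z • ouOp d)) T) ∧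
    -- it is a holomorphic extension of the semigroup,
    DifferentiableOn ℂ (expNegL d) {z : ℂ | 0 < z.re} ∧
    (∀ t : ℝ≥0, 0 < t → expNegL d ((t : ℝ) : ℂ) = semigroupOf (-(ouOp d)) t) ∧
    -- and the identity persists for complex time.
    (∀ z : ℂ, 0 < z.re →
      let s : ℂ := (1 - Complex.exp (-z)) / (1 + Complex.exp (-z))
      ∃ hs : 0 < s.re,
        expNegL d z = (1 + s) ^ d • weylQP (gaussianSymbol d s hs)) := by
  have hE := isHilbertSum_ouOp d
  have hc := isClosed_ouOp (d := d)
  have hsym := isSymmetricGraph_ouOp (d := d)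
  -- Real time is the case `z = 1` at time `t`; complex time is the parameter `z` at time `1`.
  have hone : -(ouOp d) = -((1 : ℂ) • ouOp d) := by rw [one_smul]
  have h1re : (0 : ℝ) < (1 : ℂ).re := by simp
  have hexp : ∀ (z : ℂ) (hz : 0 < z.re), expNegL d z =
      diagSemigroup (isHilbertSum_ouOp d) z hz.le 1 := fun z hz => by
    rw [expNegL, semigroupOf_eq_diagSemigroup hE hc hsym hz]
  refine ⟨?_, fun t ht => ?_, fun z hz => existsUnique_semigroup hE hc hsym hz,
    differentiableOn_diagSemigroup hE _ hexp, fun t ht => ?_, fun z hz => ?_⟩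
  · rw [hone]
    exact existsUnique_semigroup hE hc hsym h1re
  · intro s
    have hq : ‖Complex.exp (-((t : ℝ) : ℂ))‖ < 1 :=
      norm_cexp_neg_lt_one (by simpa using ht)
    have hs : (s : ℂ) = (1 - Complex.exp (-((t : ℝ) : ℂ))) / (1 + Complex.exp (-((t : ℝ) : ℂ))) := by
      simp only [s]
      push_cast
      rfl
    have hs0 : 0 < (s : ℂ).re := by
      rw [hs]
      exact re_mobius_pos hq
    refine ⟨hs0, ?_⟩
    rw [hone, semigroupOf_eq_diagSemigroup hE hc hsym h1re]
    refine diagSemigroup_eq_weylQP hs0 _ t ?_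
    rw [hs, mobius_involutive hq, one_mul]
  · have ht' : 0 < ((t : ℝ) : ℂ).re := by simpa using ht
    rw [hexp _ ht', hone, semigroupOf_eq_diagSemigroup hE hc hsym h1re]
    -- On plane waves both semigroups depend only on the product of parameter and time, here `t · 1
    -- = 1 · t`.
    refine clm_ext_wave d fun ξ => ?_
    rw [diagSemigroup_wave, diagSemigroup_wave]
    simp
  · intro s
    have hq := norm_cexp_neg_lt_one hz
    have hs0 : 0 < s.re := re_mobius_pos hq
    refine ⟨hs0, ?_⟩
    rw [hexp z hz]
    refine diagSemigroup_eq_weylQP hs0 _ 1 ?_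
    rw [mobius_involutive hq]
    simp
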